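/- Fix an integer $K\ge 0$ and, for every $n$, consider the factor augmented regression model $$Y=\boldsymbol f^\top\boldsymbol\gamma^*+\boldsymbol u^\top\boldsymbol\beta^*+\varepsilon,\qquad \boldsymbol x=\boldsymbol B\boldsymbol f+\boldsymbol u,$$ with $\boldsymbol B\in\mathbb R^{p\times K}$, $\boldsymbol f\in\mathbb R^K$, $\boldsymbol u\in\mathbb R^p$, where $p=p_n$, the parameters and the distribution may depend on $n$, $\boldsymbol u$ and $\boldsymbol f$ are uncorrelated, $\mathbb E\varepsilon=0$ and $\varepsilon$ is independent of $(\boldsymbol u,\boldsymbol f)$. Let $(\boldsymbol x_i,\boldsymbol f_i,\boldsymbol u_i,\varepsilon_i,Y_i)$, $i=1,\dots,n$, be i.i.d. copies of $(\boldsymbol x,\boldsymbol f,\boldsymbol u,\varepsilon,Y)$, and let $\boldsymbol X\in\mathbb R^{n\times p}$ have rows $\boldsymbol x_i^\top$. Put $\boldsymbol\Sigma_{\boldsymbol u}=\mathbb E(\boldsymbol u\boldsymbol u^\top)$, $\boldsymbol\Sigma=\mathrm{Cov}(\boldsymbol x)$. For a random variable let $\|Z\|_{\psi_2}=\inf\{c>0:\mathbb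 E\exp(Z^2/c^2)\le 2\}$, and for a random vector $\|\boldsymbol z\|_{\psi_2}=\sup_{\|\boldsymbol c\|_2=1}\|\boldsymbol c^\top\boldsymbol z\|_{\psi_2}$. Write $\|\boldsymbol A\|_{\max}=\max_{j,k}|A_{jk}|$, $\|\boldsymbol A\|_1=\max_k\sum_j|A_{jk}|$, and $a_n=O_{\mathbb P}(b_n)$ if $\Pr(|a_n|\le c\,b_n)\to1$ for some constant $c<\infty$. Assume, with constants that do not depend on $n$ (the bounds being required for all large $n$): 1. $\mathbb E\boldsymbol f=\boldsymbol 0$, $\mathbb E\boldsymbol u=\boldsymbol 0$, $\mathrm{Cov}(\boldsymbol f)=\boldsymbol I_K$, and $\boldsymbol B^\top\boldsymbol B$ is diagonal; $\|\boldsymbol f\|_{\psi_2}$, $\|\boldsymbol u\|_{\psi_2}$, $\|\boldsymbol u^\top\boldsymbol\beta^*\|_{\psi_2}\le c_0$; the eigenvalues of $p^{-1}\boldsymbol B^\top\boldsymbol B$ are bounded away from $0$ and $\infty$; $\|\boldsymbol B\|_{\max}=O(1)$ and $\|\boldsymbol\Sigma_{\boldsymbol u}\|_1=O(1)$; and there are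 $0<c_1<c_2$ with $c_1<\lambda_{\min}(\boldsymbol\Sigma_{\boldsymbol u})\le\lambda_{\max}(\boldsymbol\Sigma_{\boldsymbol u})\le c_2$ and $\min_{k,l}\mathrm{Var}(u_ku_l)>c_1$. 2. $\boldsymbol\Lambda=\mathrm{diag}(\lambda_1,\dots,\lambda_K)$ and $\boldsymbol\Gamma\in\mathbb R^{p\times K}$ consist of the $K$ largest eigenvalues of $\boldsymbol\Sigma$ and corresponding orthonormal eigenvectors, and $\hat{\boldsymbol\Sigma}$, $\hat{\boldsymbol\Lambda}$ (diagonal), $\hat{\boldsymbol\Gamma}$ are estimators of $\boldsymbol\Sigma,\boldsymbol\Lambda,\boldsymbol\Gamma$ with $\|\hat{\boldsymbol\Sigma}-\boldsymbol\Sigma\|_{\max}=O_{\mathbb P}\{\sqrt{(\log p)/n}\}$, $\|(\hat{\boldsymbol\Lambda}-\boldsymbol\Lambda)\hat{\boldsymbol\Lambda}^{-1}\|_{\max}=O_{\mathbb P}\{\sqrt{(\log p)/n}\}$, $\|\hat{\boldsymbol\Gamma}-\boldsymbol\Gamma\|_{\max}=O_{\mathbb P}\{\sqrt{(\log p)/(np)}\}$.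 3. $\|\varepsilon\|_{\psi_2}\le c_3$ for a constant $c_3>0$. 4. $p\asymp n^a$ for some $2/3<a<2$, and $\|p^{-1}\boldsymbol B_k^\top\boldsymbol x\|_{\psi_2}\le c$ for a constant $c$ and every column $\boldsymbol B_k$ of $\boldsymbol B$. Let $\hat K$ be an estimator of $K$ with $\Pr(\hat K=K)\to1$, let the columns of $\hat{\boldsymbol F}/\sqrt n\in\mathbb R^{n\times\hat K}$ be (any choice of) orthonormal eigenvectors of $\boldsymbol X\boldsymbol X^\top$ for its $\hat K$ largest eigenvalues, and let $\hat{\boldsymbol B}=n^{-1}\boldsymbol X^\top\hat{\boldsymbol F}$, $\hat{\boldsymbol U}=\boldsymbol X-\hat{\boldsymbol F}\hat{\boldsymbol B}^\top$, with rows $\hat{\boldsymbol u}_i^\top$. Then, as $n\to\infty$ (so that $p\to\infty$), $$\frac{\{n(n-1)\}^{-1}\sum_{i\ne j}(\hat{\boldsymbol u}_i^\top\hat{\boldsymbol u}_j)^2}{\mathrm{tr}(\boldsymbol\Sigma_{\boldsymbol u}^2)}\longrightarrow 1\quad\text{in probability.}$$ -/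

import Mathlib

open MeasureTheory ProbabilityTheory Filter Topology
open scoped ENNReal Matrix

noncomputable section

/-! ### Norms -/

/-- The sub-Gaussian norm `‖X‖_{ψ₂} = inf {c > 0 : E exp (X² / c²) ≤ 2}`
(equal to `∞` if there is no such `c`). -/
def subGaussianNorm {Ω : Type*} [MeasurableSpace Ω] (P : Measure Ω) (X : Ω → ℝ) : ℝ≥0∞ :=
  ⨅ (c : ℝ) (_ : 0 < c)
    (_ : ∫⁻ ω, ENNReal.ofReal (Real.exp ((X ω) ^ 2 / c ^ 2)) ∂P ≤ 2), ENNReal.ofReal c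

/-- The sub-Gaussian norm of a random vector,
`‖x‖_{ψ₂} = sup {‖cᵀ x‖_{ψ₂} : ‖c‖₂ = 1}`. -/
def vecSubGaussianNorm {Ω : Type*} [MeasurableSpace Ω] (P : Measure Ω) {m : ℕ}
    (x : Ω → Fin m → ℝ) : ℝ≥0∞ :=
  ⨆ (c : Fin m → ℝ) (_ : ∑ j, (c j) ^ 2 = 1), subGaussianNorm P (fun ω => c ⬝ᵥ x ω)

/-- The element-wise max-norm `max_{j,k} |A_{jk}|` (zero for an empty matrix). -/
def matMaxNorm {l m : ℕ} (A : Matrix (Fin l) (Fin m) ℝ) : ℝ :=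
  ⨆ jk : Fin l × Fin m, |A jk.1 jk.2|

/-- The matrix `ℓ₁`-norm `max_k ∑_j |A_{jk}|` (zero for an empty matrix). -/
def matOneNorm {l m : ℕ} (A : Matrix (Fin l) (Fin m) ℝ) : ℝ :=
  ⨆ k : Fin m, ∑ j : Fin l, |A j k|

/-- `a_n = O_P (b_n)`: for some finite constant `c`, `Pr (|a_n| ≤ c b_n) → 1`. -/
def IsBigOInProb {Ω : ℕ → Type*} [∀ n, MeasurableSpace (Ω n)] (P : ∀ n, Measure (Ω n))
    (a : ∀ n, Ω n → ℝ) (b : ℕ → ℝ) : Prop :=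
  ∃ c : ℝ, Tendsto (fun n => P n {ω | ¬ (|a n ω| ≤ c * b n)}) atTop (𝓝 0)

/-! ### Leading eigenvalues and eigenvectors -/

/-- `lam` lists the `k` largest eigenvalues (with multiplicity, in decreasing order) of the
symmetric matrix `A`, and the columns of `G` are corresponding orthonormal eigenvectors: they are
the first `k` items of a spectral decomposition `A = V diag(μ) Vᵀ` with `V` orthogonal and
`μ` decreasing. Nothing is fixed about the choice of `V` (signs, repeated eigenvalues). -/
def IsLeadingEigensystem {m k : ℕ} (A : Matrix (Fin m) (Fin m) ℝ) (lam : Fin k → ℝ)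
    (G : Matrix (Fin m) (Fin k) ℝ) : Prop :=
  ∃ (hk : k ≤ m) (V : Matrix (Fin m) (Fin m) ℝ) (μ : Fin m → ℝ),
    V ∈ Matrix.orthogonalGroup (Fin m) ℝ ∧ Antitone μ ∧
    A = V * Matrix.diagonal μ * Vᵀ ∧
    (∀ j, lam j = μ (Fin.castLE hk j)) ∧
    (∀ i j, G i j = V i (Fin.castLE hk j))

/-! ### The factor augmented regression model -/

/-- Parameters, generic variables `(f, u, ε)` and a sample `(f_i, u_i, ε_i)`, `i = 1, …, n`, of a
factor augmented regression model with `K` factors and `p` covariates. -/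
structure FARM (K p n : ℕ) (Ω : Type*) where
  /-- factor loadings -/
  B : Matrix (Fin p) (Fin K) ℝ
  /-- regression coefficients of the factors -/
  γ : Fin K → ℝ
  /-- regression coefficients of the idiosyncratic component -/
  β : Fin p → ℝ
  /-- latent factors -/
  f : Ω → Fin K → ℝ
  /-- idiosyncratic component -/
  u : Ω → Fin p → ℝ
  /-- random error -/
  ε : Ω → ℝ
  /-- sample of latent factors -/
  fs : Fin n → Ω → Fin K → ℝ
  /-- sample of idiosyncratic components -/
  us : Fin n → Ω → Fin p → ℝ
  /-- sample of random errors -/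
  εs : Fin n → Ω → ℝ

namespace FARM

variable {K p n : ℕ} {Ω : Type*}

/-- The covariate vector `x = B f + u`. -/
def x (M : FARM K p n Ω) (ω : Ω) : Fin p → ℝ := M.B *ᵥ M.f ω + M.u ω

/-- The response `Y = fᵀ γ + uᵀ β + ε`. -/
def Y (M : FARM K p n Ω) (ω : Ω) : ℝ := M.f ω ⬝ᵥ M.γ + M.u ω ⬝ᵥ M.β + M.ε ω

/-- The observed covariates `x_i = B f_i + u_i`. -/
def xs (M : FARM K p n Ω) (i : Fin n) (ω : Ω) : Fin p → ℝ := M.B *ᵥ M.fs i ω + M.us i ω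

/-- The observed responses `Y_i = f_iᵀ γ + u_iᵀ β + ε_i`. -/
def Ys (M : FARM K p n Ω) (i : Fin n) (ω : Ω) : ℝ :=
  M.fs i ω ⬝ᵥ M.γ + M.us i ω ⬝ᵥ M.β + M.εs i ω

/-- The `n × p` data matrix with rows `x_i`. -/
def X (M : FARM K p n Ω) (ω : Ω) : Matrix (Fin n) (Fin p) ℝ := Matrix.of fun i j => M.xs i ω j

/-- `Σ_u = E (u uᵀ)`. -/
def SigmaU [MeasurableSpace Ω] (M : FARM K p n Ω) (P : Measure Ω) : Matrix (Fin p) (Fin p) ℝ :=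
  Matrix.of fun j k => ∫ ω, M.u ω j * M.u ω k ∂P

/-- The covariance matrix of `x`. -/
def SigmaX [MeasurableSpace Ω] (M : FARM K p n Ω) (P : Measure Ω) : Matrix (Fin p) (Fin p) ℝ :=
  Matrix.of fun j k => covariance (fun ω => M.x ω j) (fun ω => M.x ω k) P

/-- The standing probabilistic assumptions of the model: `u` and `f` are uncorrelated, `ε` is
centred and independent of `(u, f)`, and the sample consists of i.i.d. copies of `(f, u, ε)`
(hence, with `x_i` and `Y_i` given by the model equations, of `(x, f, u, ε, Y)`). -/
structure IsModel [MeasurableSpace Ω] (M : FARM K p n Ω) (P : Measure Ω) : Prop where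
  aemeasurable_f : AEMeasurable M.f P
  aemeasurable_u : AEMeasurable M.u P
  aemeasurable_ε : AEMeasurable M.ε P
  uncorrelated : ∀ j k, covariance (fun ω => M.u ω j) (fun ω => M.f ω k) P = 0
  mean_ε : ∫ ω, M.ε ω ∂P = 0
  indep_ε : IndepFun M.ε (fun ω => (M.u ω, M.f ω)) P
  indep_sample : iIndepFun (fun i ω => (M.fs i ω, M.us i ω, M.εs i ω)) P
  ident_sample : ∀ i, IdentDistrib (fun ω => (M.fs i ω, M.us i ω, M.εs i ω))
    (fun ω => (M.f ω, M.u ω, M.ε ω)) P P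

/-- Identifiability: `E f = 0`, `E u = 0`, `Cov f = I_K` and `Bᵀ B` is diagonal. -/
structure IsIdentified [MeasurableSpace Ω] (M : FARM K p n Ω) (P : Measure Ω) : Prop where
  mean_f : ∀ k, ∫ ω, M.f ω k ∂P = 0
  mean_u : ∀ j, ∫ ω, M.u ω j ∂P = 0
  cov_f : ∀ k l, covariance (fun ω => M.f ω k) (fun ω => M.f ω l) P
    = (1 : Matrix (Fin K) (Fin K) ℝ) k l
  diag_B : (M.Bᵀ * M.B).IsDiag

/-- The quantitative regularity conditions on factors, loadings and idiosyncratic components.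
The eigenvalues of `p⁻¹ Bᵀ B` lie in `[b₁, b₂]`. -/
structure IsRegular [MeasurableSpace Ω] (M : FARM K p n Ω) (P : Measure Ω)
    (c₀ b₁ b₂ C₁ C₂ c₁ c₂ : ℝ) : Prop where
  subGaussian_f : vecSubGaussianNorm P M.f ≤ ENNReal.ofReal c₀
  subGaussian_u : vecSubGaussianNorm P M.u ≤ ENNReal.ofReal c₀
  subGaussian_uβ : subGaussianNorm P (fun ω => M.u ω ⬝ᵥ M.β) ≤ ENNReal.ofReal c₀
  eigen_B : ∀ t ∈ spectrum ℝ ((p : ℝ)⁻¹ • (M.Bᵀ * M.B)), b₁ ≤ t ∧ t ≤ b₂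
  max_B : matMaxNorm M.B ≤ C₁
  one_SigmaU : matOneNorm (M.SigmaU P) ≤ C₂
  eigen_SigmaU : ∀ t ∈ spectrum ℝ (M.SigmaU P), c₁ < t ∧ t ≤ c₂
  var_uu : ∀ k l, c₁ < variance (fun ω => M.u ω k * M.u ω l) P

end FARM

/-! ### Principal component estimators -/

/-- The columns of `Fhat / √n` are (orthonormal) eigenvectors of `X Xᵀ` that correspond to its
`k` largest eigenvalues. -/
def IsPCAFactor {n p k : ℕ} (X : Matrix (Fin n) (Fin p) ℝ) (Fhat : Matrix (Fin n) (Fin k) ℝ) :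
    Prop :=
  ∃ lam : Fin k → ℝ, IsLeadingEigensystem (X * Xᵀ) lam ((Real.sqrt n)⁻¹ • Fhat)

/-- The estimated loadings `B̂ = n⁻¹ Xᵀ F̂`. -/
def pcaLoadings {n p k : ℕ} (X : Matrix (Fin n) (Fin p) ℝ) (Fhat : Matrix (Fin n) (Fin k) ℝ) :
    Matrix (Fin p) (Fin k) ℝ :=
  (n : ℝ)⁻¹ • (Xᵀ * Fhat)

/-- The residual matrix `Û = X - F̂ B̂ᵀ`; its rows are the `û_i`. -/
def pcaResiduals {n p k : ℕ} (X : Matrix (Fin n) (Fin p) ℝ) (Fhat : Matrix (Fin n) (Fin k) ℝ) :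
    Matrix (Fin n) (Fin p) ℝ :=
  X - Fhat * (pcaLoadings X Fhat)ᵀ

/-- `{n (n - 1)}⁻¹ ∑_{i ≠ j} (u_iᵀ u_j)²` for the rows `u_i` of `U`. -/
def traceSqEstimator {n p : ℕ} (U : Matrix (Fin n) (Fin p) ℝ) : ℝ :=
  ((n : ℝ) * ((n : ℝ) - 1))⁻¹ * ∑ i, ∑ j, if i = j then 0 else (U i ⬝ᵥ U j) ^ 2

end

/-! ### Quadratic forms, Frobenius norms and ranks -/

/-! The estimator is a squared Frobenius norm of the off-diagonal part of the residual Gram matrix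
`R * Rᵀ`, and it is compared with the same quantity for the true idiosyncratic Gram matrix `U * Uᵀ`.
The comparison is deterministic. Passing to residuals deletes the `K` leading eigenvalues of `X *
Xᵀ`, and since `X - U` has rank at most `K`, Weyl's inequality bounds the remaining ones by `s`, the
largest eigenvalue of `U * Uᵀ`. Hence `R * Rᵀ - U * Uᵀ` has rank at most `4 * K` and operator norm
at most `s`, so its squared Frobenius norm is at most `4 * K * s ^ 2`
(`sum_sq_residual_gram_sub_le`). How well the factors are estimated plays no role.

The target, `n (n - 1) tr(Σ_u²)`, is at least of order `n² p`, so it suffices that `s` is `o(n √p)`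
in probability and that the oracle sum concentrates. For `s`, the Gram matrix is split into diagonal
and off-diagonal parts. The diagonal entries `‖u_i‖²` have exponential tails on the scale `p`, and
`n √p` exceeds `p` by a power of `n` exactly because `a < 2`. The off-diagonal part `A` satisfies
`‖A‖⁴ ≤ ‖A²‖_F²`, whose mean is a sum over four-cycles: non-degenerate cycles give `tr(Σ_u⁴) = O(p)`
each, degenerate ones number `O(n³)` and cost `O(p²)` each, so the total is `O(n³ p² + n⁴ p) = o(n⁴
p²)`. The oracle sum is handled by Chebyshev: terms with disjoint index pairs are uncorrelated,
leaving a variance `O(n³ p²)`. -/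

theorem Matrix.IsHermitian.exists_orthogonal_diag {m : ℕ} {A : Matrix (Fin m) (Fin m) ℝ}
    (hA : A.IsHermitian) :
    ∃ V : Matrix (Fin m) (Fin m) ℝ, Vᵀ * V = 1 ∧
      A = V * Matrix.diagonal hA.eigenvalues * Vᵀ := by
  refine ⟨(hA.eigenvectorUnitary : Matrix (Fin m) (Fin m) ℝ), ?_, ?_⟩
  · exact Unitary.coe_star_mul_self hA.eigenvectorUnitary
  · have h := hA.spectral_theorem
    rw [Unitary.conjStarAlgAut_apply] at h
    exact h

theorem Matrix.diag_conj_mul_self {m : ℕ} {V : Matrix (Fin m) (Fin m) ℝ} (hV : Vᵀ * V = 1)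
    (d : Fin m → ℝ) :
    ((V * Matrix.diagonal d * Vᵀ) * (V * Matrix.diagonal d * Vᵀ)) =
      V * Matrix.diagonal (fun i => d i ^ 2) * Vᵀ := by
  calc _ = V * Matrix.diagonal d * (Vᵀ * V) * Matrix.diagonal d * Vᵀ := by
        simp only [Matrix.mul_assoc]
    _ = _ := by
        rw [hV, Matrix.mul_one, Matrix.mul_assoc V, Matrix.diagonal_mul_diagonal]
        simp only [sq]

theorem Matrix.trace_diag_conj {m : ℕ} {V : Matrix (Fin m) (Fin m) ℝ} (hV : Vᵀ * V = 1)
    (d : Fin m → ℝ) : (V * Matrix.diagonal d * Vᵀ).trace = ∑ i, d i := by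
  rw [Matrix.trace_mul_cycle, hV, Matrix.one_mul, Matrix.trace_diagonal]

theorem Matrix.IsHermitian.trace_sq {m : ℕ} {A : Matrix (Fin m) (Fin m) ℝ}
    (hA : A.IsHermitian) : (A ^ 2).trace = ∑ i, hA.eigenvalues i ^ 2 := by
  obtain ⟨V, hV, h⟩ := hA.exists_orthogonal_diag
  rw [sq]
  conv_lhs => rw [h]
  rw [Matrix.diag_conj_mul_self hV, Matrix.trace_diag_conj hV]

theorem Matrix.IsHermitian.trace_pow_four {m : ℕ} {A : Matrix (Fin m) (Fin m) ℝ}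
    (hA : A.IsHermitian) : (A ^ 4).trace = ∑ i, hA.eigenvalues i ^ 4 := by
  obtain ⟨V, hV, h⟩ := hA.exists_orthogonal_diag
  rw [show 4 = 2 * 2 from rfl, pow_mul, sq, sq]
  conv_lhs => rw [h]
  rw [Matrix.diag_conj_mul_self hV, Matrix.diag_conj_mul_self hV, Matrix.trace_diag_conj hV]
  simp only [← pow_mul]

theorem Matrix.IsHermitian.sum_sq_eq {m : ℕ} {A : Matrix (Fin m) (Fin m) ℝ}
    (hA : A.IsHermitian) : ∑ i, ∑ j, A i j ^ 2 = (A ^ 2).trace := by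
  have hs : ∀ i j, A j i = A i j := fun i j => by simpa using hA.apply i j
  simp only [sq, Matrix.trace, Matrix.diag_apply, Matrix.mul_apply, hs]

/-- A symmetric matrix of rank at most `r` whose quadratic form is bounded by `s` has squared
Frobenius norm at most `r s²`. -/
theorem Matrix.IsHermitian.sum_sq_le_rank_mul {m r : ℕ} {D : Matrix (Fin m) (Fin m) ℝ}
    (hD : D.IsHermitian) (hr : D.rank ≤ r) {s : ℝ}
    (hs : ∀ w, |w ⬝ᵥ D *ᵥ w| ≤ s * (w ⬝ᵥ w)) :
    ∑ i, ∑ j, D i j ^ 2 ≤ r * s ^ 2 := by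
  classical
  rw [hD.sum_sq_eq, hD.trace_sq]
  have hev : ∀ i, |hD.eigenvalues i| ≤ s := by
    intro i
    have h1 : (hD.eigenvectorBasis i : Fin m → ℝ) ⬝ᵥ (hD.eigenvectorBasis i : Fin m → ℝ) = 1 := by
      have := hD.eigenvectorBasis.orthonormal.1 i
      have h2 : ‖hD.eigenvectorBasis i‖ ^ 2 = 1 := by rw [this]; norm_num
      rw [EuclideanSpace.real_norm_sq_eq] at h2
      simpa [dotProduct, sq] using h2
    have h2 := hs (hD.eigenvectorBasis i)
    rwa [hD.mulVec_eigenvectorBasis, dotProduct_smul, h1, smul_eq_mul, mul_one, mul_one] at h2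
  -- Only nonzero eigenvalues contribute, and the rank counts them.
  have hle : ∀ i, hD.eigenvalues i ^ 2 ≤ if hD.eigenvalues i ≠ 0 then s ^ 2 else 0 := by
    intro i
    split_ifs with h
    · exact sq_le_sq' (abs_le.1 (hev i)).1 (abs_le.1 (hev i)).2
    · simp [not_not.1 h]
  calc ∑ i, hD.eigenvalues i ^ 2 ≤ ∑ i, if hD.eigenvalues i ≠ 0 then s ^ 2 else 0 :=
        Finset.sum_le_sum fun i _ => hle i
    _ = (D.rank : ℝ) * s ^ 2 := by
        rw [hD.rank_eq_card_non_zero_eigs, Fintype.card_subtype, ← Finset.sum_filter,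
          Finset.sum_const, nsmul_eq_mul]
    _ ≤ r * s ^ 2 := by gcongr

theorem Matrix.dotProduct_mulVec_sq_le {m : ℕ} (A : Matrix (Fin m) (Fin m) ℝ) (w : Fin m → ℝ) :
    (w ⬝ᵥ A *ᵥ w) ^ 2 ≤ (∑ i, ∑ j, A i j ^ 2) * (w ⬝ᵥ w) ^ 2 := by
  have h1 : (w ⬝ᵥ A *ᵥ w) ^ 2 ≤ (∑ i, w i ^ 2) * ∑ i, (A *ᵥ w) i ^ 2 :=
    Finset.sum_mul_sq_le_sq_mul_sq _ _ _
  have h2 : ∑ i, (A *ᵥ w) i ^ 2 ≤ ∑ i, (∑ j, A i j ^ 2) * ∑ j, w j ^ 2 :=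
    Finset.sum_le_sum fun i _ => Finset.sum_mul_sq_le_sq_mul_sq Finset.univ (A i) w
  have hw : ∑ i, w i ^ 2 = w ⬝ᵥ w := by simp [dotProduct, sq]
  rw [← Finset.sum_mul] at h2
  rw [hw] at h1 h2
  have h0 : 0 ≤ w ⬝ᵥ w := by rw [← hw]; positivity
  nlinarith [mul_le_mul_of_nonneg_left h2 h0]

/-- The quadratic form of a symmetric matrix `A` is controlled by the Frobenius norm of `A²`. -/
theorem Matrix.IsHermitian.abs_dotProduct_mulVec_le {m : ℕ} {A : Matrix (Fin m) (Fin m) ℝ}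
    (hA : A.IsHermitian) {t : ℝ} (ht : 0 ≤ t) (h : ∑ i, ∑ j, (A * A) i j ^ 2 ≤ t ^ 4)
    (w : Fin m → ℝ) : |w ⬝ᵥ A *ᵥ w| ≤ t * (w ⬝ᵥ w) := by
  have hw : ∑ i, w i ^ 2 = w ⬝ᵥ w := by simp [dotProduct, sq]
  have h0 : 0 ≤ w ⬝ᵥ w := by rw [← hw]; positivity
  -- Cauchy–Schwarz twice: once for `w` against `A w`, then for the form of `A * A`, which equals
  -- `‖A w‖²` by symmetry.
  have h1 : (w ⬝ᵥ A *ᵥ w) ^ 2 ≤ (∑ i, w i ^ 2) * ∑ i, (A *ᵥ w) i ^ 2 :=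
    Finset.sum_mul_sq_le_sq_mul_sq _ _ _
  have h2 : ∑ i, (A *ᵥ w) i ^ 2 = w ⬝ᵥ (A * A) *ᵥ w := by
    have hT : Aᵀ = A := by simpa [Matrix.IsHermitian] using hA
    have : w ⬝ᵥ (A * A) *ᵥ w = (A *ᵥ w) ⬝ᵥ (A *ᵥ w) := by
      rw [← Matrix.mulVec_mulVec, Matrix.dotProduct_mulVec, ← Matrix.mulVec_transpose, hT]
    rw [this]; simp [dotProduct, sq]
  have h3 := Matrix.dotProduct_mulVec_sq_le (A * A) w
  have h4 : (w ⬝ᵥ (A * A) *ᵥ w) ^ 2 ≤ (t ^ 2 * (w ⬝ᵥ w)) ^ 2 := by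
    calc _ ≤ _ := h3
      _ ≤ t ^ 4 * (w ⬝ᵥ w) ^ 2 := by gcongr
      _ = _ := by ring
  have h5 : w ⬝ᵥ (A * A) *ᵥ w ≤ t ^ 2 * (w ⬝ᵥ w) :=
    le_of_sq_le_sq h4 (by positivity)
  apply abs_le_of_sq_le_sq _ (by positivity)
  rw [h2, hw] at h1
  nlinarith [mul_le_mul_of_nonneg_left h5 h0]

theorem Matrix.rank_add_le_add {m l : ℕ} (A B : Matrix (Fin m) (Fin l) ℝ) :
    (A + B).rank ≤ A.rank + B.rank := by
  unfold Matrix.rank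
  rw [Matrix.mulVecLin_add]
  exact (Submodule.finrank_mono (LinearMap.range_add_le _ _)).trans
    (Submodule.finrank_add_le_finrank_add_finrank _ _)

/-! ### Residuals of principal component factors -/

/-- Weyl's inequality for a low-rank perturbation: the eigenvalues of `X Xᵀ`, `X = F Bᵀ + U`,
beyond the `K`-th one are bounded by the largest eigenvalue of `U Uᵀ`. -/
theorem eigenvalue_le_of_factor {n p K : ℕ} {X U : Matrix (Fin n) (Fin p) ℝ}
    {F : Matrix (Fin n) (Fin K) ℝ} {B : Matrix (Fin p) (Fin K) ℝ} (hX : X = F * Bᵀ + U)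
    {s : ℝ} (hs : ∀ w, w ⬝ᵥ (U * Uᵀ) *ᵥ w ≤ s * (w ⬝ᵥ w))
    {V : Matrix (Fin n) (Fin n) ℝ} {μ : Fin n → ℝ} (hV : Vᵀ * V = 1) (hμ : Antitone μ)
    (hXX : X * Xᵀ = V * Matrix.diagonal μ * Vᵀ) (i₀ : Fin n) (hi₀ : K ≤ i₀) : μ i₀ ≤ s := by
  classical
  -- Courant–Fischer by dimension count: the kernel consists of the `y` supported on indices up to
  -- `i₀` for which `V y` is orthogonal to the columns of `F`. The target has dimension `K + (n - 1
  -- - i₀) < n`, so a nonzero `y` exists; on `w = V y` the factor part of `Xᵀ` vanishes.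
  let L : (Fin n → ℝ) →ₗ[ℝ] (Fin K → ℝ) × ({i : Fin n // i₀ < i} → ℝ) :=
    ((Fᵀ * V).mulVecLin).prod (LinearMap.pi fun i => LinearMap.proj i.1)
  have hL : LinearMap.ker L ≠ ⊥ := by
    apply LinearMap.ker_ne_bot_of_finrank_lt
    have hc : Fintype.card {i : Fin n // i₀ < i} = n - 1 - i₀ := by
      rw [Fintype.card_subtype]
      have : (Finset.univ.filter fun i : Fin n => i₀ < i) = Finset.Ioi i₀ := by ext; simp
      rw [this, Fin.card_Ioi]
    simp only [Module.finrank_prod, Module.finrank_fintype_fun_eq_card, Fintype.card_fin, hc]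
    have := i₀.2
    omega
  obtain ⟨y, hy, hy0⟩ := (Submodule.ne_bot_iff _).1 hL
  have hy1 : (Fᵀ * V) *ᵥ y = 0 := congrArg Prod.fst (LinearMap.mem_ker.1 hy)
  have hy2 : ∀ i, i₀ < i → y i = 0 := fun i hi =>
    congrFun (congrArg Prod.snd (LinearMap.mem_ker.1 hy)) ⟨i, hi⟩
  set w := V *ᵥ y with hw
  have hFw : Fᵀ *ᵥ w = 0 := by rw [hw, Matrix.mulVec_mulVec, hy1]
  have hVw : Vᵀ *ᵥ w = y := by rw [hw, Matrix.mulVec_mulVec, hV, Matrix.one_mulVec]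
  have hww : w ⬝ᵥ w = y ⬝ᵥ y := by
    nth_rewrite 2 [hw]
    rw [Matrix.dotProduct_mulVec, ← Matrix.mulVec_transpose, hVw]
  have hquad : ∀ Z : Matrix (Fin n) (Fin p) ℝ, w ⬝ᵥ (Z * Zᵀ) *ᵥ w = (Zᵀ *ᵥ w) ⬝ᵥ (Zᵀ *ᵥ w) := by
    intro Z
    rw [← Matrix.mulVec_mulVec, Matrix.dotProduct_mulVec, Matrix.mulVec_transpose]
  have hXw : Xᵀ *ᵥ w = Uᵀ *ᵥ w := by
    rw [hX, Matrix.transpose_add, Matrix.transpose_mul, Matrix.add_mulVec,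
      ← Matrix.mulVec_mulVec, hFw, Matrix.mulVec_zero, zero_add]
  have h1 : w ⬝ᵥ (X * Xᵀ) *ᵥ w ≤ s * (y ⬝ᵥ y) := by
    rw [hquad, hXw, ← hquad, ← hww]; exact hs w
  have h2 : w ⬝ᵥ (X * Xᵀ) *ᵥ w = ∑ i, μ i * y i ^ 2 := by
    rw [hXX, ← Matrix.mulVec_mulVec, ← Matrix.mulVec_mulVec, hVw, Matrix.dotProduct_mulVec,
      ← Matrix.mulVec_transpose, hVw]
    simp only [dotProduct, Matrix.mulVec_diagonal]
    exact Finset.sum_congr rfl fun i _ => by ring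
  have h3 : μ i₀ * (y ⬝ᵥ y) ≤ ∑ i, μ i * y i ^ 2 := by
    simp only [dotProduct, Finset.mul_sum]
    refine Finset.sum_le_sum fun i _ => ?_
    rcases lt_or_ge i₀ i with hi | hi
    · simp [hy2 i hi]
    · have := mul_le_mul_of_nonneg_right (hμ hi) (mul_self_nonneg (y i))
      nlinarith
  have h4 : 0 < y ⬝ᵥ y := by
    have hne := mt dotProduct_self_eq_zero.1 hy0
    have : 0 ≤ y ⬝ᵥ y := Finset.sum_nonneg fun i _ => mul_self_nonneg (y i)
    exact lt_of_le_of_ne this (Ne.symm hne)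
  rw [h2] at h1
  exact le_of_mul_le_mul_right (h3.trans h1) h4

/-- The Gram matrix of the residuals differs from that of the idiosyncratic components by a
matrix whose Frobenius norm is controlled by the operator norm of the latter. -/
theorem sum_sq_residual_gram_sub_le {n p K : ℕ} {X U : Matrix (Fin n) (Fin p) ℝ}
    {F : Matrix (Fin n) (Fin K) ℝ} {B : Matrix (Fin p) (Fin K) ℝ} (hX : X = F * Bᵀ + U)
    {s : ℝ} (hs : ∀ w, w ⬝ᵥ (U * Uᵀ) *ᵥ w ≤ s * (w ⬝ᵥ w)) (hs0 : 0 ≤ s) (hn : 0 < n)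
    {k : ℕ} (hk : k = K) {Fhat : Matrix (Fin n) (Fin k) ℝ} (hF : IsPCAFactor X Fhat) :
    ∑ i, ∑ j, ((pcaResiduals X Fhat * (pcaResiduals X Fhat)ᵀ - U * Uᵀ) i j) ^ 2
      ≤ ((4 * K : ℕ) : ℝ) * s ^ 2 := by
  classical
  subst hk
  obtain ⟨lam, hkn, V, μ, hVo, hμ, hXX, -, hG⟩ := hF
  have hV1 : Vᵀ * V = 1 := by
    have := (Matrix.mem_orthogonalGroup_iff' (Fin n) ℝ).1 hVo; exact this
  have hV2 : V * Vᵀ = 1 := by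
    have := (Matrix.mem_orthogonalGroup_iff (Fin n) ℝ).1 hVo; exact this
  set G := (Real.sqrt n)⁻¹ • Fhat with hGdef
  set R := pcaResiduals X Fhat with hR
  have hn' : (0 : ℝ) < n := by exact_mod_cast hn
  have hFF : (n : ℝ)⁻¹ • (Fhat * Fhatᵀ) = G * Gᵀ := by
    rw [hGdef, Matrix.transpose_smul, Matrix.smul_mul, Matrix.mul_smul, smul_smul, ← mul_inv,
      Real.mul_self_sqrt hn'.le]
  have hRX : R = X - G * (Gᵀ * X) := by
    rw [hR, pcaResiduals, pcaLoadings, Matrix.transpose_smul, Matrix.transpose_mul,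
      Matrix.transpose_transpose, Matrix.mul_smul, ← Matrix.mul_assoc, ← Matrix.mul_assoc,
      ← Matrix.smul_mul, hFF]
  let e : Fin n → ℝ := fun i => if (i : ℕ) < k then 1 else 0
  have hGG : G * Gᵀ = V * Matrix.diagonal e * Vᵀ := by
    ext i j
    rw [Matrix.mul_apply, Matrix.mul_apply]
    simp only [Matrix.mul_diagonal, Matrix.transpose_apply, hG, e]
    simp only [mul_ite, mul_one, mul_zero, ite_mul, zero_mul]
    rw [← Finset.sum_filter]
    refine Finset.sum_bij (fun a _ => Fin.castLE hkn a) ?_ ?_ ?_ ?_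
    · intro a _; simp
    · intro a _ b _ h; simpa using h
    · intro b hb; exact ⟨⟨b, by simpa using hb⟩, by simp, by ext; simp⟩
    · intro a _; rfl
  have hRV : R = V * Matrix.diagonal (fun i => 1 - e i) * Vᵀ * X := by
    have : Matrix.diagonal (fun i => 1 - e i) = 1 - Matrix.diagonal e := by
      rw [← Matrix.diagonal_one, Matrix.diagonal_sub]
    rw [this, Matrix.mul_sub, Matrix.sub_mul, Matrix.mul_one, hV2, ← hGG, Matrix.sub_mul,
      Matrix.one_mul, Matrix.mul_assoc, hRX]
  -- `G * Gᵀ` is a spectral projection of `X * Xᵀ`, so the residual Gram matrix keeps the same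
  -- eigenvectors, with the `k` leading eigenvalues replaced by zero.
  have hRR : R * Rᵀ = V * Matrix.diagonal (fun i => (1 - e i) ^ 2 * μ i) * Vᵀ := by
    have h1 : R * Rᵀ = V * Matrix.diagonal (fun i => 1 - e i) * Vᵀ * (X * Xᵀ) *
        (V * Matrix.diagonal (fun i => 1 - e i) * Vᵀ) := by
      conv_lhs => rw [hRV]
      simp only [Matrix.transpose_mul, Matrix.transpose_transpose, Matrix.diagonal_transpose,
        Matrix.mul_assoc]
    rw [h1, hXX]
    calc _ = V * (Matrix.diagonal (fun i => 1 - e i) * (Vᵀ * V) * Matrix.diagonal μ * (Vᵀ * V) *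
          Matrix.diagonal (fun i => 1 - e i)) * Vᵀ := by simp only [Matrix.mul_assoc]
      _ = _ := by
        rw [hV1, Matrix.mul_one, Matrix.mul_one, Matrix.diagonal_mul_diagonal,
          Matrix.diagonal_mul_diagonal]
        congr 3
        ext i
        ring
  have hquad : ∀ (Z : Matrix (Fin n) (Fin p) ℝ) w, 0 ≤ w ⬝ᵥ (Z * Zᵀ) *ᵥ w := by
    intro Z w
    rw [← Matrix.mulVec_mulVec, Matrix.dotProduct_mulVec, ← Matrix.mulVec_transpose]
    exact Finset.sum_nonneg fun i _ => mul_self_nonneg _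
  have hRs : ∀ w, w ⬝ᵥ (R * Rᵀ) *ᵥ w ≤ s * (w ⬝ᵥ w) := by
    intro w
    have hww : w ⬝ᵥ w = (Vᵀ *ᵥ w) ⬝ᵥ (Vᵀ *ᵥ w) := by
      rw [Matrix.mulVec_transpose, ← Matrix.dotProduct_mulVec, ← Matrix.mulVec_transpose,
        Matrix.mulVec_mulVec, hV2, Matrix.one_mulVec]
    rw [hRR, ← Matrix.mulVec_mulVec, ← Matrix.mulVec_mulVec, Matrix.dotProduct_mulVec,
      ← Matrix.mulVec_transpose, hww]
    simp only [dotProduct, Matrix.mulVec_diagonal, Finset.mul_sum]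
    refine Finset.sum_le_sum fun i _ => ?_
    by_cases hi : (i : ℕ) < k
    · simp only [e, hi, if_true]
      have := mul_nonneg hs0 (mul_self_nonneg ((Vᵀ *ᵥ w) i))
      simpa using this
    · have h1 := eigenvalue_le_of_factor hX hs hV1 hμ hXX i (not_lt.1 hi)
      have := mul_le_mul_of_nonneg_right h1 (mul_self_nonneg ((Vᵀ *ᵥ w) i))
      simp only [e, hi, if_false]
      nlinarith
  have hherm : (R * Rᵀ - U * Uᵀ).IsHermitian := by
    simp [Matrix.IsHermitian, Matrix.transpose_mul]
  -- `R = U + E` with `E` of rank at most `2 * k`, and the difference is `E * Rᵀ + U * Eᵀ`.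
  have hrank : (R * Rᵀ - U * Uᵀ).rank ≤ 4 * k := by
    have hE : R = U + (F * Bᵀ + (-G) * (Gᵀ * X)) := by
      rw [hRX, Matrix.neg_mul, ← sub_eq_add_neg, ← add_sub_assoc, add_comm U, ← hX]
    have hr : (F * Bᵀ + (-G) * (Gᵀ * X)).rank ≤ 2 * k := by
      refine (Matrix.rank_add_le_add _ _).trans ?_
      have h1 := (Matrix.rank_mul_le_left F Bᵀ).trans (Matrix.rank_le_width F)
      have h2 := (Matrix.rank_mul_le_left (-G) (Gᵀ * X)).trans (Matrix.rank_le_width (-G))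
      omega
    set E := F * Bᵀ + (-G) * (Gᵀ * X)
    have hd : R * Rᵀ - U * Uᵀ = E * Rᵀ + U * Eᵀ := by
      conv_lhs => rw [hE]
      conv_rhs => rw [hE]
      simp only [Matrix.transpose_add, Matrix.mul_add, Matrix.add_mul]
      abel
    rw [hd]
    refine (Matrix.rank_add_le_add _ _).trans ?_
    have h1 := Matrix.rank_mul_le_left E Rᵀ
    have h2 := Matrix.rank_mul_le_right U Eᵀ
    rw [Matrix.rank_transpose] at h2
    omega
  refine hherm.sum_sq_le_rank_mul hrank fun w => ?_
  rw [Matrix.sub_mulVec, dotProduct_sub]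
  have a1 := hquad R w
  have a2 := hquad U w
  have a3 := hRs w
  have a4 := hs w
  -- Both forms lie between `0` and `s * (w ⬝ᵥ w)`, so their difference is bounded by `s`, not `2 *
  -- s`.
  rw [abs_le]
  constructor <;> linarith

/-! ### Sub-Gaussian laws -/

/-- All one-dimensional projections of `ν` have sub-Gaussian norm at most `b`. -/
def SubGaussianLaw {p : ℕ} (ν : Measure (Fin p → ℝ)) (b : ℝ) : Prop :=
  ∀ w : Fin p → ℝ, ∑ j, w j ^ 2 = 1 →
    ∫⁻ x, ENNReal.ofReal (Real.exp ((w ⬝ᵥ x) ^ 2 / b ^ 2)) ∂ν ≤ 2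

/-- Strict inequality yields an admissible `c < b` without knowing that the infimum is attained; the
exponential moment decreases in the scale. -/
theorem lintegral_exp_le_two_of_subGaussianNorm_lt {Ω : Type*} [MeasurableSpace Ω]
    {P : Measure Ω} {Z : Ω → ℝ} {b : ℝ} (h : subGaussianNorm P Z < ENNReal.ofReal b) :
    ∫⁻ ω, ENNReal.ofReal (Real.exp ((Z ω) ^ 2 / b ^ 2)) ∂P ≤ 2 := by
  simp only [subGaussianNorm, iInf_lt_iff] at h
  obtain ⟨c, hc, hle, hcb⟩ := h
  have hcb' : c < b := (ENNReal.ofReal_lt_ofReal_iff_of_nonneg hc.le).1 hcb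
  refine le_trans (lintegral_mono fun ω => ?_) hle
  gcongr

theorem pow_four_le_exp {b : ℝ} (hb : 0 < b) (t : ℝ) :
    t ^ 4 ≤ 2 * b ^ 4 * Real.exp (t ^ 2 / b ^ 2) := by
  have h := Real.quadratic_le_exp_of_nonneg (show 0 ≤ t ^ 2 / b ^ 2 by positivity)
  have h2 : t ^ 4 = b ^ 4 * (t ^ 2 / b ^ 2) ^ 2 := by field_simp
  have h3 : 0 ≤ t ^ 2 / b ^ 2 := by positivity
  rw [h2]
  have : (t ^ 2 / b ^ 2) ^ 2 ≤ 2 * Real.exp (t ^ 2 / b ^ 2) := by nlinarith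
  nlinarith [mul_le_mul_of_nonneg_left this (show 0 ≤ b ^ 4 by positivity)]

section Law

variable {p : ℕ} {ν : Measure (Fin p → ℝ)} {b : ℝ}

/-- Normalise `w` and integrate `pow_four_le_exp`; the constant is its `2` times the bound `2` on
the exponential moment. -/
theorem SubGaussianLaw.lintegral_dotProduct_pow_four_le (h : SubGaussianLaw ν b) (hb : 0 < b)
    (w : Fin p → ℝ) :
    ∫⁻ x, ENNReal.ofReal ((w ⬝ᵥ x) ^ 4) ∂ν ≤ ENNReal.ofReal (4 * b ^ 4 * (w ⬝ᵥ w) ^ 2) := by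
  have hw0 : 0 ≤ w ⬝ᵥ w := Finset.sum_nonneg fun i _ => mul_self_nonneg _
  rcases hw0.eq_or_lt with h0 | h0
  · have : w = 0 := dotProduct_self_eq_zero.1 h0.symm
    simp [this]
  set r := Real.sqrt (w ⬝ᵥ w) with hr
  have hr0 : 0 < r := Real.sqrt_pos.2 h0
  have hr2 : r ^ 2 = w ⬝ᵥ w := Real.sq_sqrt hw0
  have hunit : ∑ j, (r⁻¹ • w) j ^ 2 = 1 := by
    have : ∑ j, (r⁻¹ • w) j ^ 2 = (r ^ 2)⁻¹ * (w ⬝ᵥ w) := by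
      simp only [Pi.smul_apply, smul_eq_mul, dotProduct, Finset.mul_sum]
      exact Finset.sum_congr rfl fun j _ => by ring
    rw [this, hr2, inv_mul_cancel₀ h0.ne']
  have key := h _ hunit
  calc ∫⁻ x, ENNReal.ofReal ((w ⬝ᵥ x) ^ 4) ∂ν
      ≤ ∫⁻ x, ENNReal.ofReal (2 * b ^ 4 * r ^ 4) *
          ENNReal.ofReal (Real.exp (((r⁻¹ • w) ⬝ᵥ x) ^ 2 / b ^ 2)) ∂ν := by
        refine lintegral_mono fun x => ?_
        rw [← ENNReal.ofReal_mul (by positivity)]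
        apply ENNReal.ofReal_le_ofReal
        have h1 := pow_four_le_exp hb ((r⁻¹ • w) ⬝ᵥ x)
        have h2 : (w ⬝ᵥ x) ^ 4 = r ^ 4 * ((r⁻¹ • w) ⬝ᵥ x) ^ 4 := by
          rw [smul_dotProduct, smul_eq_mul]; field_simp
        rw [h2]
        nlinarith [mul_le_mul_of_nonneg_left h1 (show 0 ≤ r ^ 4 by positivity)]
    _ = ENNReal.ofReal (2 * b ^ 4 * r ^ 4) *
          ∫⁻ x, ENNReal.ofReal (Real.exp (((r⁻¹ • w) ⬝ᵥ x) ^ 2 / b ^ 2)) ∂ν :=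
        lintegral_const_mul' _ _ ENNReal.ofReal_ne_top
    _ ≤ ENNReal.ofReal (2 * b ^ 4 * r ^ 4) * 2 := by gcongr
    _ = ENNReal.ofReal (4 * b ^ 4 * (w ⬝ᵥ w) ^ 2) := by
        rw [← hr2, show (2 : ℝ≥0∞) = ENNReal.ofReal 2 by simp,
          ← ENNReal.ofReal_mul (by positivity)]
        congr 1; ring

theorem SubGaussianLaw.lintegral_coord_pow_four_le (h : SubGaussianLaw ν b) (hb : 0 < b)
    (j : Fin p) : ∫⁻ x, ENNReal.ofReal (x j ^ 4) ∂ν ≤ ENNReal.ofReal (4 * b ^ 4) := by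
  simpa using h.lintegral_dotProduct_pow_four_le hb (Pi.single j 1)

/-- Cauchy–Schwarz over the `p` coordinates, which may be dependent. -/
theorem SubGaussianLaw.lintegral_normSq_sq_le (h : SubGaussianLaw ν b) (hb : 0 < b) :
    ∫⁻ x, ENNReal.ofReal ((x ⬝ᵥ x) ^ 2) ∂ν ≤ ENNReal.ofReal (4 * b ^ 4 * p ^ 2) := by
  calc ∫⁻ x, ENNReal.ofReal ((x ⬝ᵥ x) ^ 2) ∂ν
      ≤ ∫⁻ x, ENNReal.ofReal p * ∑ j, ENNReal.ofReal (x j ^ 4) ∂ν := by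
        refine lintegral_mono fun x => ?_
        rw [← ENNReal.ofReal_sum_of_nonneg (fun j _ => by positivity),
          ← ENNReal.ofReal_mul (by positivity)]
        apply ENNReal.ofReal_le_ofReal
        have := sq_sum_le_card_mul_sum_sq (s := Finset.univ) (f := fun j => x j * x j)
        simp only [Finset.card_univ, Fintype.card_fin] at this
        refine this.trans_eq ?_
        congr 1
        exact Finset.sum_congr rfl fun j _ => by ring
    _ = ENNReal.ofReal p * ∑ j, ∫⁻ x, ENNReal.ofReal (x j ^ 4) ∂ν := by
        rw [lintegral_const_mul' _ _ ENNReal.ofReal_ne_top, lintegral_finsetSum]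
        intro j _
        fun_prop
    _ ≤ ENNReal.ofReal p * ∑ _j : Fin p, ENNReal.ofReal (4 * b ^ 4) := by
        gcongr with j
        exact h.lintegral_coord_pow_four_le hb j
    _ = ENNReal.ofReal (4 * b ^ 4 * p ^ 2) := by
        rw [Finset.sum_const, Finset.card_univ, Fintype.card_fin, nsmul_eq_mul,
          ← ENNReal.ofReal_natCast, ← ENNReal.ofReal_mul (by positivity),
          ← ENNReal.ofReal_mul (by positivity)]
        congr 1; ring

theorem SubGaussianLaw.memLp_coord [IsFiniteMeasure ν] (h : SubGaussianLaw ν b) (hb : 0 < b)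
    (j : Fin p) : MemLp (fun x : Fin p → ℝ => x j) 2 ν := by
  rw [memLp_two_iff_integrable_sq (measurable_pi_apply j).aestronglyMeasurable]
  have h4 : Integrable (fun x : Fin p → ℝ => x j ^ 4) ν := by
    refine ⟨((measurable_pi_apply j).pow_const 4).aestronglyMeasurable, ?_⟩
    rw [hasFiniteIntegral_iff_ofReal (ae_of_all _ fun x => by positivity)]
    exact (h.lintegral_coord_pow_four_le hb j).trans_lt ENNReal.ofReal_lt_top
  refine (h4.add (integrable_const (1 : ℝ))).mono'
    ((measurable_pi_apply j).pow_const 2).aestronglyMeasurable (ae_of_all _ fun x => ?_)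
  rw [Real.norm_of_nonneg (by positivity)]
  simp only [Pi.add_apply]
  nlinarith [sq_nonneg (x j ^ 2 - 1)]

/-- The squared Euclidean norm has exponential tails on the scale of the dimension. -/
theorem SubGaussianLaw.measure_normSq_ge_le (h : SubGaussianLaw ν b) (hb : 0 < b)
    (hp : 0 < p) (t : ℝ) :
    ν {x | p * b ^ 2 * t ≤ x ⬝ᵥ x} ≤ ENNReal.ofReal (2 * Real.exp (-t)) := by
  have hp' : (0 : ℝ) < p := by exact_mod_cast hp
  have hsub : {x : Fin p → ℝ | p * b ^ 2 * t ≤ x ⬝ᵥ x} ⊆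
      {x | ENNReal.ofReal (Real.exp t) ≤ ENNReal.ofReal (p : ℝ)⁻¹ *
        ∑ j, ENNReal.ofReal (Real.exp (x j ^ 2 / b ^ 2))} := by
    intro x hx
    simp only [Set.mem_ofPred_eq] at hx ⊢
    rw [← ENNReal.ofReal_sum_of_nonneg (fun j _ => by positivity),
      ← ENNReal.ofReal_mul (by positivity)]
    apply ENNReal.ofReal_le_ofReal
    -- Jensen replaces independence of the coordinates: the exponential of the average is at most
    -- the average of the exponentials, each of mean at most `2`. Markov then gives the tail.
    have hJ := convexOn_exp.map_sum_le (t := Finset.univ) (w := fun _ : Fin p => (p : ℝ)⁻¹)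
      (p := fun j => x j ^ 2 / b ^ 2) (fun _ _ => by positivity)
      (by rw [Finset.sum_const, Finset.card_univ, Fintype.card_fin, nsmul_eq_mul,
        mul_inv_cancel₀ hp'.ne']) (fun _ _ => Set.mem_univ _)
    simp only [smul_eq_mul, ← Finset.mul_sum] at hJ
    refine le_trans (Real.exp_le_exp.2 ?_) hJ
    rw [← Finset.sum_div, show ∑ j, x j ^ 2 = x ⬝ᵥ x by simp [dotProduct, sq],
      inv_mul_eq_div, div_div, le_div_iff₀ (by positivity)]
    linarith
  calc ν {x | p * b ^ 2 * t ≤ x ⬝ᵥ x}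
      ≤ (∫⁻ x, ENNReal.ofReal (p : ℝ)⁻¹ *
        ∑ j, ENNReal.ofReal (Real.exp (x j ^ 2 / b ^ 2)) ∂ν) / ENNReal.ofReal (Real.exp t) :=
        (measure_mono hsub).trans (meas_ge_le_lintegral_div
          (Measurable.aemeasurable (Measurable.const_mul (by fun_prop) _))
          (by simpa using Real.exp_pos t) ENNReal.ofReal_ne_top)
    _ = (ENNReal.ofReal (p : ℝ)⁻¹ *
        ∑ j, ∫⁻ x, ENNReal.ofReal (Real.exp (x j ^ 2 / b ^ 2)) ∂ν) /
          ENNReal.ofReal (Real.exp t) := by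
        rw [lintegral_const_mul' _ _ ENNReal.ofReal_ne_top, lintegral_finsetSum]
        intro j _
        fun_prop
    _ ≤ (ENNReal.ofReal (p : ℝ)⁻¹ * ∑ _j : Fin p, 2) / ENNReal.ofReal (Real.exp t) := by
        gcongr with j
        simpa using h (Pi.single j 1) (by simp [Pi.single_apply])
    _ = ENNReal.ofReal (2 * Real.exp (-t)) := by
        rw [Finset.sum_const, Finset.card_univ, Fintype.card_fin, nsmul_eq_mul,
          ← ENNReal.ofReal_natCast, show (2 : ℝ≥0∞) = ENNReal.ofReal 2 by simp,
          ← ENNReal.ofReal_mul hp'.le, ← ENNReal.ofReal_mul (by positivity),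
          ← ENNReal.ofReal_div_of_pos (Real.exp_pos t), Real.exp_neg, div_eq_mul_inv,
          inv_mul_cancel_left₀ hp'.ne']

/-- Second-moment matrix of a law. -/
noncomputable def secondMoment (ν : Measure (Fin p → ℝ)) : Matrix (Fin p) (Fin p) ℝ :=
  Matrix.of fun j k => ∫ x, x j * x k ∂ν

theorem secondMoment_symm (i j : Fin p) : secondMoment ν i j = secondMoment ν j i := by
  simp only [secondMoment, Matrix.of_apply, mul_comm]

end Law

/-! ### Gram matrices of i.i.d. samples -/

section Sample

variable {n p : ℕ} {ν : Measure (Fin p → ℝ)} [IsProbabilityMeasure ν] {b : ℝ}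

theorem iIndepFun_eval (ν : Measure (Fin p → ℝ)) [IsProbabilityMeasure ν] :
    iIndepFun (fun (i : Fin n) (x : Fin n → Fin p → ℝ) => x i) (Measure.pi fun _ => ν) :=
  iIndepFun_pi (X := fun _ x => x) fun _ => aemeasurable_id

theorem map_eval_pair {i j : Fin n} (hij : i ≠ j) :
    (Measure.pi fun _ : Fin n => ν).map (fun x => (x i, x j)) = ν.prod ν := by
  have h := ((iIndepFun_eval (n := n) ν).indepFun hij)
  rw [indepFun_iff_map_prod_eq_prod_map_map (measurable_pi_apply i).aemeasurable
    (measurable_pi_apply j).aemeasurable] at h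
  rw [h]
  congr 1 <;> exact (measurePreserving_eval (fun _ : Fin n => ν) _).map_eq

/-- With one vector frozen at `y`, the inner product is a one-dimensional projection of size `‖y‖`.
This gives order `p²`, whereas bounding by norms would give `p⁴`. -/
theorem SubGaussianLaw.lintegral_inner_pow_four_le (h : SubGaussianLaw ν b) (hb : 0 < b)
    {i j : Fin n} (hij : i ≠ j) :
    ∫⁻ x, ENNReal.ofReal ((x i ⬝ᵥ x j) ^ 4) ∂(Measure.pi fun _ : Fin n => ν)
      ≤ ENNReal.ofReal (16 * b ^ 8 * p ^ 2) := by
  have hm : Measurable fun z : (Fin p → ℝ) × (Fin p → ℝ) => ENNReal.ofReal ((z.1 ⬝ᵥ z.2) ^ 4) := by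
    unfold dotProduct; fun_prop
  calc _ = ∫⁻ z, ENNReal.ofReal ((z.1 ⬝ᵥ z.2) ^ 4) ∂(ν.prod ν) := by
        rw [← map_eval_pair hij, lintegral_map hm (by fun_prop)]
    _ = ∫⁻ y, ∫⁻ z, ENNReal.ofReal ((y ⬝ᵥ z) ^ 4) ∂ν ∂ν := lintegral_prod _ hm.aemeasurable
    _ ≤ ∫⁻ y, ENNReal.ofReal (4 * b ^ 4) * ENNReal.ofReal ((y ⬝ᵥ y) ^ 2) ∂ν := by
        refine lintegral_mono fun y => ?_
        rw [← ENNReal.ofReal_mul (by positivity)]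
        exact h.lintegral_dotProduct_pow_four_le hb y
    _ = ENNReal.ofReal (4 * b ^ 4) * ∫⁻ y, ENNReal.ofReal ((y ⬝ᵥ y) ^ 2) ∂ν :=
        lintegral_const_mul' _ _ ENNReal.ofReal_ne_top
    _ ≤ ENNReal.ofReal (4 * b ^ 4) * ENNReal.ofReal (4 * b ^ 4 * p ^ 2) := by
        gcongr; exact h.lintegral_normSq_sq_le hb
    _ = _ := by
        rw [← ENNReal.ofReal_mul (by positivity)]; congr 1; ring

@[fun_prop]
theorem measurable_inner_eval (i j : Fin n) :
    Measurable fun x : Fin n → Fin p → ℝ => x i ⬝ᵥ x j := by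
  unfold dotProduct; fun_prop

theorem SubGaussianLaw.integrable_inner_pow_four (h : SubGaussianLaw ν b) (hb : 0 < b)
    {i j : Fin n} (hij : i ≠ j) :
    Integrable (fun x => (x i ⬝ᵥ x j) ^ 4) (Measure.pi fun _ : Fin n => ν) := by
  refine ⟨by fun_prop, ?_⟩
  rw [hasFiniteIntegral_iff_ofReal (ae_of_all _ fun x => by positivity)]
  exact (h.lintegral_inner_pow_four_le hb hij).trans_lt ENNReal.ofReal_lt_top

theorem SubGaussianLaw.integral_inner_pow_four_le (h : SubGaussianLaw ν b) (hb : 0 < b)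
    {i j : Fin n} (hij : i ≠ j) :
    ∫ x, (x i ⬝ᵥ x j) ^ 4 ∂(Measure.pi fun _ : Fin n => ν) ≤ 16 * b ^ 8 * p ^ 2 := by
  rw [integral_eq_lintegral_of_nonneg_ae (ae_of_all _ fun x => by positivity) (by fun_prop)]
  exact ENNReal.toReal_le_of_le_ofReal (by positivity) (h.lintegral_inner_pow_four_le hb hij)

theorem SubGaussianLaw.memLp_inner_sq (h : SubGaussianLaw ν b) (hb : 0 < b)
    {i j : Fin n} (hij : i ≠ j) :
    MemLp (fun x => (x i ⬝ᵥ x j) ^ 2) 2 (Measure.pi fun _ : Fin n => ν) := by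
  rw [memLp_two_iff_integrable_sq (by fun_prop)]
  simpa only [← pow_mul] using h.integrable_inner_pow_four hb hij

theorem SubGaussianLaw.integrable_coord_mul (h : SubGaussianLaw ν b) (hb : 0 < b)
    (j k : Fin p) : Integrable (fun x : Fin p → ℝ => x j * x k) ν :=
  (h.memLp_coord hb j).integrable_mul (h.memLp_coord hb k)

theorem SubGaussianLaw.integral_inner_sq (h : SubGaussianLaw ν b) (hb : 0 < b)
    {i j : Fin n} (hij : i ≠ j) :
    ∫ x, (x i ⬝ᵥ x j) ^ 2 ∂(Measure.pi fun _ : Fin n => ν) = (secondMoment ν ^ 2).trace := by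
  have hcm : Measurable fun z : (Fin p → ℝ) × (Fin p → ℝ) => (z.1 ⬝ᵥ z.2) ^ 2 := by
    unfold dotProduct; fun_prop
  have hmap : ∫ x, (x i ⬝ᵥ x j) ^ 2 ∂(Measure.pi fun _ : Fin n => ν) =
      ∫ z, (z.1 ⬝ᵥ z.2) ^ 2 ∂(ν.prod ν) := by
    rw [← map_eval_pair hij, integral_map (by fun_prop) hcm.aestronglyMeasurable]
  have hexp : ∀ z : (Fin p → ℝ) × (Fin p → ℝ),
      (z.1 ⬝ᵥ z.2) ^ 2 = ∑ a, ∑ c, (z.1 a * z.1 c) * (z.2 a * z.2 c) := by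
    intro z
    rw [sq, dotProduct, Finset.sum_mul_sum]
    exact Finset.sum_congr rfl fun a _ => Finset.sum_congr rfl fun c _ => by ring
  have hint : ∀ a c, Integrable (fun z : (Fin p → ℝ) × (Fin p → ℝ) =>
      (z.1 a * z.1 c) * (z.2 a * z.2 c)) (ν.prod ν) := fun a c =>
    (h.integrable_coord_mul hb a c).mul_prod (h.integrable_coord_mul hb a c)
  rw [hmap]
  simp only [hexp]
  rw [integral_finsetSum _ fun a _ => integrable_finsetSum _ fun c _ => hint a c]
  rw [sq, Matrix.trace]
  refine Finset.sum_congr rfl fun a _ => ?_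
  rw [integral_finsetSum _ fun c _ => hint a c, Matrix.diag_apply, Matrix.mul_apply]
  refine Finset.sum_congr rfl fun c _ => ?_
  rw [secondMoment_symm c a]
  exact integral_prod_mul (fun y : Fin p → ℝ => y a * y c) (fun y : Fin p → ℝ => y a * y c)

end Sample

/-! ### Off-diagonal Gram matrix: four-cycle moments and concentration -/

section Sample

variable {n p : ℕ} {ν : Measure (Fin p → ℝ)} [IsProbabilityMeasure ν] {b : ℝ}

/-- Distinct members of an i.i.d. sample form an i.i.d. sample; this reduces four-cycles to a
product of four copies of `ν`. -/
theorem measurePreserving_comp_injective {m : ℕ} {e : Fin m → Fin n}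
    (he : Function.Injective e) :
    MeasurePreserving (fun (x : Fin n → Fin p → ℝ) t => x (e t))
      (Measure.pi fun _ => ν) (Measure.pi fun _ => ν) := by
  refine ⟨by fun_prop, ?_⟩
  have h := ((iIndepFun_eval (n := n) ν).precomp he).map_fun_eq_pi_map
    fun t => (measurable_pi_apply (e t)).aemeasurable
  refine h.trans ?_
  congr 1
  ext1 t
  exact (measurePreserving_eval (fun _ : Fin n => ν) (e t)).map_eq

theorem Matrix.trace_pow_four_eq_sum (S : Matrix (Fin p) (Fin p) ℝ) :
    (S ^ 4).trace = ∑ a, ∑ b, ∑ c, ∑ d, S d a * S a b * S b c * S c d := by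
  have h : S ^ 4 = S * (S * (S * S)) := by simp only [pow_succ, pow_zero, one_mul, mul_assoc]
  rw [h, Matrix.trace]
  simp only [Matrix.diag_apply, Matrix.mul_apply, Finset.mul_sum]
  refine Finset.sum_congr rfl fun a _ => Finset.sum_congr rfl fun b _ =>
    Finset.sum_congr rfl fun c _ => Finset.sum_congr rfl fun d _ => ?_
  ring

/-- The expectation of a product of inner products along a four-cycle. -/
theorem SubGaussianLaw.integral_four_cycle (h : SubGaussianLaw ν b) (hb : 0 < b)
    {i j k l : Fin n} (hij : i ≠ j) (hik : i ≠ k) (hil : i ≠ l) (hjk : j ≠ k) (hjl : j ≠ l)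
    (hkl : k ≠ l) :
    ∫ x, (x i ⬝ᵥ x k) * (x k ⬝ᵥ x j) * ((x i ⬝ᵥ x l) * (x l ⬝ᵥ x j))
      ∂(Measure.pi fun _ : Fin n => ν) = (secondMoment ν ^ 4).trace := by
  let e : Fin 4 → Fin n := ![i, k, j, l]
  have he : Function.Injective e := by
    intro s t hst
    fin_cases s <;> fin_cases t <;> simp_all [e, eq_comm]
  have hmp := measurePreserving_comp_injective (ν := ν) he
  -- The components of `q` are the coordinates summed along the edges `ik`, `kj`, `jl`, `li`; `g q
  -- t` collects the two factors at the `t`-th vertex of the cycle.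
  let g : Fin p × Fin p × Fin p × Fin p → Fin 4 → (Fin p → ℝ) → ℝ := fun q =>
    ![fun y => y q.2.2.2 * y q.1, fun y => y q.1 * y q.2.1, fun y => y q.2.1 * y q.2.2.1,
      fun y => y q.2.2.1 * y q.2.2.2]
  have hg : ∀ q t, Integrable (g q t) ν := by
    intro q t
    fin_cases t <;> exact h.integrable_coord_mul hb _ _
  have hint : ∀ q, Integrable (fun x : Fin n → Fin p → ℝ => ∏ t, g q t (x (e t)))
      (Measure.pi fun _ => ν) := fun q =>
    hmp.integrable_comp_of_integrable (Integrable.fintype_prod (hg q))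
  have hval : ∀ q, ∫ x : Fin n → Fin p → ℝ, ∏ t, g q t (x (e t)) ∂(Measure.pi fun _ => ν) =
      secondMoment ν q.2.2.2 q.1 * secondMoment ν q.1 q.2.1 * secondMoment ν q.2.1 q.2.2.1 *
        secondMoment ν q.2.2.1 q.2.2.2 := by
    intro q
    have h1 : AEStronglyMeasurable (fun z : Fin 4 → Fin p → ℝ => ∏ t, g q t (z t))
        (Measure.map (fun (x : Fin n → Fin p → ℝ) t => x (e t)) (Measure.pi fun _ => ν)) := by
      rw [hmp.map_eq]
      exact (Integrable.fintype_prod (hg q)).aestronglyMeasurable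
    have h2 := integral_map hmp.measurable.aemeasurable h1
    rw [← h2, hmp.map_eq, integral_fintype_prod_eq_prod, Fin.prod_univ_four]
    rfl
  have hexp : ∀ x : Fin n → Fin p → ℝ,
      (x i ⬝ᵥ x k) * (x k ⬝ᵥ x j) * ((x i ⬝ᵥ x l) * (x l ⬝ᵥ x j)) =
        ∑ q, ∏ t, g q t (x (e t)) := by
    intro x
    have hq : ∀ q, ∏ t, g q t (x (e t)) = (x i q.2.2.2 * x i q.1) * (x k q.1 * x k q.2.1) *
        (x j q.2.1 * x j q.2.2.1) * (x l q.2.2.1 * x l q.2.2.2) := by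
      intro q
      rw [Fin.prod_univ_four]
      rfl
    simp only [hq, Fintype.sum_prod_type]
    calc _ = (x i ⬝ᵥ x k) * ((x k ⬝ᵥ x j) * ((x l ⬝ᵥ x j) * (x i ⬝ᵥ x l))) := by ring
      _ = ∑ a, ∑ b, ∑ c, ∑ d, (x i a * x k a) * ((x k b * x j b) *
          ((x l c * x j c) * (x i d * x l d))) := by
        simp only [dotProduct, ← Finset.mul_sum, ← Finset.sum_mul]
      _ = _ := by
        refine Finset.sum_congr rfl fun a _ => Finset.sum_congr rfl fun b _ =>
          Finset.sum_congr rfl fun c _ => Finset.sum_congr rfl fun d _ => ?_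
        ring
  simp only [hexp]
  rw [integral_finsetSum _ fun q _ => hint q, Matrix.trace_pow_four_eq_sum]
  simp only [hval, Fintype.sum_prod_type]

/-- The off-diagonal part of the Gram matrix of a family of vectors. -/
def offGram (x : Fin n → Fin p → ℝ) : Matrix (Fin n) (Fin n) ℝ :=
  Matrix.of fun i j => if i = j then 0 else x i ⬝ᵥ x j

theorem offGram_apply_ne (x : Fin n → Fin p → ℝ) {i j : Fin n} (hij : i ≠ j) :
    offGram x i j = x i ⬝ᵥ x j := by simp [offGram, hij]

theorem offGram_apply_self (x : Fin n → Fin p → ℝ) (i : Fin n) : offGram x i i = 0 := by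
  simp [offGram]

theorem offGram_comm (x : Fin n → Fin p → ℝ) (i j : Fin n) :
    offGram x i j = offGram x j i := by
  simp only [offGram, Matrix.of_apply, dotProduct_comm (x i) (x j), eq_comm (a := i)]

theorem measurable_offGram (i j : Fin n) :
    Measurable fun x : Fin n → Fin p → ℝ => offGram x i j := by
  by_cases hij : i = j
  · subst hij; simp only [offGram_apply_self]; fun_prop
  · simp only [offGram_apply_ne _ hij]; fun_prop

theorem SubGaussianLaw.integrable_offGram_pow_four (h : SubGaussianLaw ν b) (hb : 0 < b)
    (i j : Fin n) :
    Integrable (fun x => offGram x i j ^ 4) (Measure.pi fun _ : Fin n => ν) := by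
  by_cases hij : i = j
  · subst hij; simp [offGram_apply_self]
  · simpa only [offGram_apply_ne _ hij] using h.integrable_inner_pow_four hb hij

theorem SubGaussianLaw.integral_offGram_pow_four_le (h : SubGaussianLaw ν b) (hb : 0 < b)
    (i j : Fin n) :
    ∫ x, offGram x i j ^ 4 ∂(Measure.pi fun _ : Fin n => ν) ≤ 16 * b ^ 8 * p ^ 2 := by
  by_cases hij : i = j
  · subst hij; simp only [offGram_apply_self]; simp; positivity
  · simpa only [offGram_apply_ne _ hij] using h.integral_inner_pow_four_le hb hij

/-- AM–GM. It bounds any cycle product by fourth moments, whichever indices coincide. -/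
theorem abs_mul_four_le (a b c d : ℝ) :
    |a * b * (c * d)| ≤ (a ^ 4 + b ^ 4 + c ^ 4 + d ^ 4) / 4 := by
  rw [abs_le]
  constructor <;> nlinarith [sq_nonneg (a * b + c * d), sq_nonneg (a * b - c * d),
    sq_nonneg (a ^ 2 - b ^ 2), sq_nonneg (c ^ 2 - d ^ 2)]

theorem integral_average_four_le {α : Type*} [MeasurableSpace α] {μ : Measure α}
    {f₁ f₂ f₃ f₄ : α → ℝ} {C : ℝ} (h₁ : Integrable f₁ μ) (h₂ : Integrable f₂ μ)
    (h₃ : Integrable f₃ μ) (h₄ : Integrable f₄ μ) (i₁ : ∫ x, f₁ x ∂μ ≤ C)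
    (i₂ : ∫ x, f₂ x ∂μ ≤ C) (i₃ : ∫ x, f₃ x ∂μ ≤ C) (i₄ : ∫ x, f₄ x ∂μ ≤ C) :
    ∫ x, (f₁ x + f₂ x + f₃ x + f₄ x) / 4 ∂μ ≤ C := by
  have e₁ : ∫ x, f₁ x + f₂ x + f₃ x + f₄ x ∂μ = ∫ x, f₁ x + f₂ x + f₃ x ∂μ + ∫ x, f₄ x ∂μ :=
    integral_add ((h₁.add h₂).add h₃) h₄
  have e₂ : ∫ x, f₁ x + f₂ x + f₃ x ∂μ = ∫ x, f₁ x + f₂ x ∂μ + ∫ x, f₃ x ∂μ :=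
    integral_add (h₁.add h₂) h₃
  rw [integral_div, e₁, e₂, integral_add h₁ h₂]
  linarith

theorem SubGaussianLaw.integrable_offGram_cycle (h : SubGaussianLaw ν b) (hb : 0 < b)
    (i j k l : Fin n) :
    Integrable (fun x => offGram x i k * offGram x k j * (offGram x i l * offGram x l j))
      (Measure.pi fun _ : Fin n => ν) := by
  have hi := h.integrable_offGram_pow_four (n := n) hb
  refine ((((hi i k).add (hi k j)).add (hi i l)).add (hi l j)).div_const 4 |>.mono' ?_ ?_
  · have := measurable_offGram (n := n) (p := p)
    exact (((this i k).mul (this k j)).mul ((this i l).mul (this l j))).aestronglyMeasurable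
  · exact ae_of_all _ fun x => abs_mul_four_le _ _ _ _

theorem SubGaussianLaw.integral_offGram_cycle_le (h : SubGaussianLaw ν b) (hb : 0 < b)
    (i j k l : Fin n) :
    ∫ x, offGram x i k * offGram x k j * (offGram x i l * offGram x l j)
      ∂(Measure.pi fun _ : Fin n => ν) ≤ 16 * b ^ 8 * p ^ 2 := by
  have hi := h.integrable_offGram_pow_four (n := n) hb
  have hle := h.integral_offGram_pow_four_le (n := n) hb
  calc _ ≤ ∫ x, (offGram x i k ^ 4 + offGram x k j ^ 4 + offGram x i l ^ 4 + offGram x l j ^ 4) / 4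
        ∂(Measure.pi fun _ : Fin n => ν) :=
        integral_mono (h.integrable_offGram_cycle hb i j k l)
          (((((hi i k).add (hi k j)).add (hi i l)).add (hi l j)).div_const 4)
          fun x => (le_abs_self _).trans (abs_mul_four_le _ _ _ _)
    _ ≤ _ := by
        exact integral_average_four_le (hi i k) (hi k j) (hi i l) (hi l j)
          (hle i k) (hle k j) (hle i l) (hle l j)

/-- A weight charging `M` to each coincidence of indices; these four properties suffice for
counting. -/
theorem exists_kronecker (n : ℕ) {M : ℝ} (hM : 0 ≤ M) :
    ∃ δ : Fin n → Fin n → ℝ, (∀ i j, i = j → δ i j = M) ∧ (∀ i j, i ≠ j → δ i j = 0) ∧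
      (∀ i j, 0 ≤ δ i j) ∧ ∀ i, ∑ j, δ i j = M :=
  ⟨fun i j => if i = j then M else 0, fun i j h => if_pos h, fun i j h => if_neg h,
    fun i j => by dsimp only; split_ifs <;> simp [hM], fun i => by simp⟩

/-- Second moment of the entries of the square of the off-diagonal Gram matrix. -/
theorem SubGaussianLaw.integral_sum_offGram_sq_le (h : SubGaussianLaw ν b) (hb : 0 < b)
    (hS : 0 ≤ (secondMoment ν ^ 4).trace) :
    Integrable (fun x => ∑ i, ∑ j, ((offGram x * offGram x) i j) ^ 2)
      (Measure.pi fun _ : Fin n => ν) ∧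
    ∫ x, ∑ i, ∑ j, ((offGram x * offGram x) i j) ^ 2 ∂(Measure.pi fun _ : Fin n => ν)
      ≤ 2 * n ^ 3 * (16 * b ^ 8 * p ^ 2) + n ^ 4 * (secondMoment ν ^ 4).trace := by
  have hexp : ∀ x : Fin n → Fin p → ℝ, ∑ i, ∑ j, ((offGram x * offGram x) i j) ^ 2 =
      ∑ q : Fin n × Fin n × Fin n × Fin n, offGram x q.1 q.2.2.1 * offGram x q.2.2.1 q.2.1 *
        (offGram x q.1 q.2.2.2 * offGram x q.2.2.2 q.2.1) := by
    intro x
    simp only [Fintype.sum_prod_type, sq, Matrix.mul_apply, Finset.sum_mul_sum]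
  simp only [hexp]
  have hint := fun q : Fin n × Fin n × Fin n × Fin n =>
    h.integrable_offGram_cycle hb q.1 q.2.1 q.2.2.1 q.2.2.2
  refine ⟨integrable_finsetSum _ fun q _ => hint q, ?_⟩
  rw [integral_finsetSum _ fun q _ => hint q]
  set M : ℝ := 16 * b ^ 8 * p ^ 2 with hM
  have hM0 : 0 ≤ M := by positivity
  obtain ⟨δ, hδ1, hδ0, hδn, hδ⟩ := exists_kronecker n hM0
  -- Coincidences `i = j` or `k = l` are charged `M`, which gives the `2 n³` terms. A coincidence
  -- between `{i, j}` and `{k, l}` kills the product, because the diagonal of `offGram` is zero.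
  -- What remains is a genuine four-cycle.
  have hq : ∀ q : Fin n × Fin n × Fin n × Fin n,
      ∫ x, offGram x q.1 q.2.2.1 * offGram x q.2.2.1 q.2.1 *
        (offGram x q.1 q.2.2.2 * offGram x q.2.2.2 q.2.1) ∂(Measure.pi fun _ : Fin n => ν) ≤
      δ q.1 q.2.1 + δ q.2.2.1 q.2.2.2 +
        (secondMoment ν ^ 4).trace := by
    rintro ⟨i, j, k, l⟩
    have hle := h.integral_offGram_cycle_le hb i j k l
    simp only
    by_cases hij : i = j
    · rw [hδ1 _ _ hij]
      linarith [hδn k l]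
    by_cases hkl : k = l
    · rw [hδ1 _ _ hkl, hδ0 _ _ hij]
      linarith
    rw [hδ0 _ _ hij, hδ0 _ _ hkl, zero_add, zero_add]
    by_cases hik : i = k
    · subst hik; simpa [offGram_apply_self] using hS
    by_cases hil : i = l
    · subst hil; simpa [offGram_apply_self] using hS
    by_cases hjk : j = k
    · subst hjk; simpa [offGram_apply_self] using hS
    by_cases hjl : j = l
    · subst hjl; simpa [offGram_apply_self] using hS
    simp only [offGram_apply_ne _ hik, offGram_apply_ne _ (Ne.symm hjk), offGram_apply_ne _ hil,
      offGram_apply_ne _ (Ne.symm hjl)]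
    exact (h.integral_four_cycle hb hij hik hil hjk hjl hkl).le
  refine (Finset.sum_le_sum fun q _ => hq q).trans_eq ?_
  simp only [Finset.sum_add_distrib, Fintype.sum_prod_type]
  simp only [Finset.sum_const, Finset.card_univ, Fintype.card_fin, nsmul_eq_mul,
    ← Finset.mul_sum, hδ]
  ring

/-- Concentration in mean square of the sum of squared off-diagonal inner products. -/
theorem SubGaussianLaw.integral_sum_offGram_sub_sq_le (h : SubGaussianLaw ν b) (hb : 0 < b) :
    Integrable (fun x => (∑ i, ∑ j, offGram x i j ^ 2 -
        n * (n - 1) * (secondMoment ν ^ 2).trace) ^ 2) (Measure.pi fun _ : Fin n => ν) ∧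
    ∫ x, (∑ i, ∑ j, offGram x i j ^ 2 - n * (n - 1) * (secondMoment ν ^ 2).trace) ^ 2
      ∂(Measure.pi fun _ : Fin n => ν) ≤ 4 * n ^ 3 * (16 * b ^ 8 * p ^ 2) := by
  set τ := (secondMoment ν ^ 2).trace with hτ
  set M : ℝ := 16 * b ^ 8 * p ^ 2 with hM
  have hM0 : 0 ≤ M := by positivity
  obtain ⟨δ, hδ1, hδ0, hδn, hδ⟩ := exists_kronecker n hM0
  let Y : Fin n × Fin n → (Fin n → Fin p → ℝ) → ℝ := fun q x =>
    if q.1 = q.2 then 0 else (x q.1 ⬝ᵥ x q.2) ^ 2 - τ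
  have hYne : ∀ q, q.1 ≠ q.2 → Y q = fun x => (x q.1 ⬝ᵥ x q.2) ^ 2 - τ := by
    intro q hq; funext x; simp [Y, hq]
  have hYeq : ∀ q, q.1 = q.2 → Y q = fun _ => 0 := by
    intro q hq; funext x; simp [Y, hq]
  have hexp : ∀ x, ∑ i, ∑ j, offGram x i j ^ 2 - n * (n - 1) * τ = ∑ q, Y q x := by
    intro x
    have h1 : ∀ i j, Y (i, j) x = offGram x i j ^ 2 - (τ - if i = j then τ else 0) := by
      intro i j
      by_cases hij : i = j
      · subst hij; simp [Y, offGram_apply_self]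
      · simp [Y, hij, offGram_apply_ne x hij]
    rw [Fintype.sum_prod_type]
    simp only [h1, Finset.sum_sub_distrib, Finset.sum_ite_eq,
      Finset.mem_univ, if_true, Finset.sum_const, Finset.card_univ, Fintype.card_fin, nsmul_eq_mul]
    ring
  have hYL : ∀ q, MemLp (Y q) 2 (Measure.pi fun _ : Fin n => ν) := by
    intro q
    by_cases hq : q.1 = q.2
    · rw [hYeq q hq]; exact MemLp.zero
    · rw [hYne q hq]
      exact (h.memLp_inner_sq hb hq).sub (memLp_const τ)
  have hY0 : ∀ q, ∫ x, Y q x ∂(Measure.pi fun _ : Fin n => ν) = 0 := by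
    intro q
    by_cases hq : q.1 = q.2
    · rw [hYeq q hq]; simp
    · rw [hYne q hq, integral_sub ((h.memLp_inner_sq hb hq).integrable one_le_two)
        (integrable_const _), h.integral_inner_sq hb hq]
      simp [hτ]
  -- The variance is at most the uncentred second moment of the square, that is, a fourth moment.
  have hY2 : ∀ q, ∫ x, Y q x ^ 2 ∂(Measure.pi fun _ : Fin n => ν) ≤ M := by
    intro q
    by_cases hq : q.1 = q.2
    · rw [hYeq q hq]; simpa using hM0
    · have hv := variance_le_expectation_sq (μ := Measure.pi fun _ : Fin n => ν)
        (X := fun x => (x q.1 ⬝ᵥ x q.2) ^ 2) (h.memLp_inner_sq hb hq).aestronglyMeasurable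
      rw [variance_eq_integral (h.memLp_inner_sq hb hq).aestronglyMeasurable.aemeasurable,
        h.integral_inner_sq hb hq] at hv
      rw [hYne q hq]
      refine hv.trans ?_
      simp only [Pi.pow_apply, ← pow_mul]
      exact h.integral_inner_pow_four_le hb hq
  have hint : ∀ q r, Integrable (fun x => Y q x * Y r x) (Measure.pi fun _ : Fin n => ν) :=
    fun q r => (hYL q).integrable_mul (hYL r)
  have hsq : ∀ x, (∑ q, Y q x) ^ 2 = ∑ q, ∑ r, Y q x * Y r x := fun x => by
    rw [sq, Finset.sum_mul_sum]
  simp only [hexp, hsq]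
  refine ⟨integrable_finsetSum _ fun q _ => integrable_finsetSum _ fun r _ => hint q r, ?_⟩
  rw [integral_finsetSum _ fun q _ => integrable_finsetSum _ fun r _ => hint q r]
  -- Disjoint index pairs are independent and centred. Each of the four possible shared indices
  -- occurs for `n³` choices, whence the factor `4 n³`.
  have hcov : ∀ q r : Fin n × Fin n, ∫ x, Y q x * Y r x ∂(Measure.pi fun _ : Fin n => ν) ≤
      δ q.1 r.1 + δ q.1 r.2 +
      (δ q.2 r.1 + δ q.2 r.2) := by
    intro q r
    have hle : ∫ x, Y q x * Y r x ∂(Measure.pi fun _ : Fin n => ν) ≤ M := by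
      have hq2 := (hYL q).integrable_sq
      have hr2 := (hYL r).integrable_sq
      calc _ ≤ ∫ x, (Y q x ^ 2 + Y r x ^ 2) / 2 ∂(Measure.pi fun _ : Fin n => ν) :=
            integral_mono (hint q r) ((hq2.add hr2).div_const 2) fun x => by
              simp only; nlinarith [sq_nonneg (Y q x - Y r x)]
        _ ≤ M := by
            rw [integral_div, integral_add hq2 hr2]; linarith [hY2 q, hY2 r]
    have n1 := hδn q.1 r.1
    have n2 := hδn q.1 r.2
    have n3 := hδn q.2 r.1
    have n4 := hδn q.2 r.2
    by_cases e1 : q.1 = r.1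
    · rw [hδ1 _ _ e1]; linarith
    by_cases e2 : q.1 = r.2
    · rw [hδ1 _ _ e2]; linarith
    by_cases e3 : q.2 = r.1
    · rw [hδ1 _ _ e3]; linarith
    by_cases e4 : q.2 = r.2
    · rw [hδ1 _ _ e4]; linarith
    have hind : IndepFun (Y q) (Y r) (Measure.pi fun _ : Fin n => ν) := by
      have h0 := (iIndepFun_eval (n := n) ν).indepFun_prodMk_prodMk
        (fun i => measurable_pi_apply i) q.1 q.2 r.1 r.2 e1 e2 e3 e4
      have hm : ∀ s : Fin n × Fin n, Measurable fun z : (Fin p → ℝ) × (Fin p → ℝ) =>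
          if s.1 = s.2 then 0 else (z.1 ⬝ᵥ z.2) ^ 2 - τ := by
        intro s
        unfold dotProduct
        split_ifs <;> fun_prop
      exact h0.comp (hm q) (hm r)
    rw [hind.integral_fun_mul_eq_mul_integral (hYL q).aestronglyMeasurable
      (hYL r).aestronglyMeasurable, hY0, zero_mul]
    linarith
  have hsum : ∑ q, ∫ x, ∑ r, Y q x * Y r x ∂(Measure.pi fun _ : Fin n => ν) ≤
      ∑ q : Fin n × Fin n, ∑ r : Fin n × Fin n, (δ q.1 r.1 +
        δ q.1 r.2 + (δ q.2 r.1 +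
        δ q.2 r.2)) := by
    refine Finset.sum_le_sum fun q _ => ?_
    rw [integral_finsetSum _ fun r _ => hint q r]
    exact Finset.sum_le_sum fun r _ => hcov q r
  refine hsum.trans_eq ?_
  simp only [Finset.sum_add_distrib, Fintype.sum_prod_type]
  simp only [Finset.sum_const, Finset.card_univ, Fintype.card_fin, nsmul_eq_mul,
    ← Finset.mul_sum, hδ]
  ring

end Sample

/-! ### Comparison of the estimator with its oracle version -/

section Deterministic

variable {n p : ℕ}

theorem traceSqEstimator_eq (R : Matrix (Fin n) (Fin p) ℝ) :
    traceSqEstimator R = ((n : ℝ) * ((n : ℝ) - 1))⁻¹ * ∑ i, ∑ j, offGram R i j ^ 2 := by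
  unfold traceSqEstimator
  congr 1
  refine Finset.sum_congr rfl fun i _ => Finset.sum_congr rfl fun j _ => ?_
  by_cases hij : i = j
  · have h0 : offGram R i j = 0 := hij ▸ offGram_apply_self R i
    rw [if_pos hij, h0]; ring
  · have h0 : offGram R i j = R i ⬝ᵥ R j := offGram_apply_ne R hij
    rw [if_neg hij, h0]

/-- Diagonal and off-diagonal parts are bounded separately: the former by its entries, the latter
through the Frobenius norm of its square. -/
theorem gram_quadraticForm_le (x : Matrix (Fin n) (Fin p) ℝ) {s t : ℝ} (ht : 0 ≤ t)
    (hs : ∀ i, x i ⬝ᵥ x i ≤ s) (hA : ∑ i, ∑ j, ((offGram x * offGram x) i j) ^ 2 ≤ t ^ 4)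
    (w : Fin n → ℝ) : w ⬝ᵥ (x * xᵀ) *ᵥ w ≤ (s + t) * (w ⬝ᵥ w) := by
  have hG : x * xᵀ = Matrix.diagonal (fun i => x i ⬝ᵥ x i) + offGram x := by
    ext i j
    have h1 : (x * xᵀ) i j = x i ⬝ᵥ x j := rfl
    rw [h1, Matrix.add_apply]
    by_cases hij : i = j
    · subst hij
      have h0 : offGram x i i = 0 := offGram_apply_self x i
      rw [Matrix.diagonal_apply_eq, h0, add_zero]
    · have h0 : offGram x i j = x i ⬝ᵥ x j := offGram_apply_ne x hij
      rw [Matrix.diagonal_apply_ne _ hij, h0, zero_add]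
  have hherm : (offGram x).IsHermitian := by
    ext i j; exact offGram_comm x j i
  have h1 := (abs_le.1 (hherm.abs_dotProduct_mulVec_le ht hA w)).2
  have h2 : w ⬝ᵥ Matrix.diagonal (fun i => x i ⬝ᵥ x i) *ᵥ w ≤ s * (w ⬝ᵥ w) := by
    simp only [dotProduct, Matrix.mulVec_diagonal, Finset.mul_sum]
    refine Finset.sum_le_sum fun i _ => ?_
    have := mul_le_mul_of_nonneg_right (hs i) (mul_self_nonneg (w i))
    simp only [dotProduct] at this
    linarith
  rw [hG, Matrix.add_mulVec, dotProduct_add, add_mul]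
  exact add_le_add h2 h1

/-- Entrywise Young inequality `2 |a d| ≤ θ a² + θ⁻¹ d²`, with `d` the difference of the Gram
entries. -/
theorem abs_sum_offGram_sub_le (R U : Matrix (Fin n) (Fin p) ℝ) {θ : ℝ} (hθ : 0 < θ) :
    |∑ i, ∑ j, offGram R i j ^ 2 - ∑ i, ∑ j, offGram U i j ^ 2| ≤
      θ * ∑ i, ∑ j, offGram U i j ^ 2 +
        (1 + θ⁻¹) * ∑ i, ∑ j, ((R * Rᵀ - U * Uᵀ) i j) ^ 2 := by
  simp only [← Finset.sum_sub_distrib, Finset.mul_sum, ← Finset.sum_add_distrib]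
  refine (Finset.abs_sum_le_sum_abs _ _).trans (Finset.sum_le_sum fun i _ => ?_)
  refine (Finset.abs_sum_le_sum_abs _ _).trans (Finset.sum_le_sum fun j _ => ?_)
  by_cases hij : i = j
  · have hR : offGram R i j = 0 := hij ▸ offGram_apply_self R i
    have hU : offGram U i j = 0 := hij ▸ offGram_apply_self U i
    rw [hR, hU, sub_self, abs_zero]
    positivity
  · have hR : offGram R i j = R i ⬝ᵥ R j := offGram_apply_ne R hij
    have hU : offGram U i j = U i ⬝ᵥ U j := offGram_apply_ne U hij
    rw [hR, hU]
    have hd : (R * Rᵀ - U * Uᵀ) i j = R i ⬝ᵥ R j - U i ⬝ᵥ U j := rfl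
    rw [hd]
    set a := U i ⬝ᵥ U j
    set r := R i ⬝ᵥ R j
    set d := r - a with hd'
    have hr : r ^ 2 - a ^ 2 = 2 * (a * d) + d ^ 2 := by rw [hd']; ring
    have h1 : 0 ≤ θ * (a - θ⁻¹ * d) ^ 2 := by positivity
    have h2 : 0 ≤ θ * (a + θ⁻¹ * d) ^ 2 := by positivity
    have e1 : θ * (a - θ⁻¹ * d) ^ 2 = θ * a ^ 2 + θ⁻¹ * d ^ 2 - 2 * (a * d) := by field_simp; ring
    have e2 : θ * (a + θ⁻¹ * d) ^ 2 = θ * a ^ 2 + θ⁻¹ * d ^ 2 + 2 * (a * d) := by field_simp; ring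
    have h3 : 0 ≤ d ^ 2 := sq_nonneg d
    have h4 : 0 ≤ θ * a ^ 2 + θ⁻¹ * d ^ 2 := by positivity
    rw [hr, abs_le]
    constructor <;> linarith

/-- The relative errors are `θ` from `u`, `2 θ` from `r` (as `u ≤ 2 Z`), and less than `δ / 2` from
`E`; `6 θ ≤ δ` makes the first two sum to at most `δ / 2`. -/
theorem abs_sub_lt_of_relative_error {r u Z E θ δ : ℝ} (hθ0 : 0 ≤ θ) (hθ1 : θ ≤ 1)
    (hθδ : 6 * θ ≤ δ) (hZ : 0 < Z) (hu : |u - Z| ≤ θ * Z) (hr : |r - u| ≤ θ * u + E)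
    (hE : E < δ / 2 * Z) : |r - Z| < δ * Z := by
  have h1 : θ * Z ≤ Z := mul_le_of_le_one_left hZ.le hθ1
  have h2 := abs_le.1 hu
  have h3 := abs_le.1 hr
  have h4 : θ * u ≤ θ * (2 * Z) := mul_le_mul_of_nonneg_left (by linarith) hθ0
  have h5 := mul_le_mul_of_nonneg_right hθδ hZ.le
  rw [abs_lt]
  constructor <;> linarith

/-- Ratio bound for the estimator on the event that the idiosyncratic sample behaves well. -/
theorem abs_ratio_sub_one_lt {K : ℕ} {X U : Matrix (Fin n) (Fin p) ℝ}
    {F : Matrix (Fin n) (Fin K) ℝ} {B : Matrix (Fin p) (Fin K) ℝ} (hX : X = F * Bᵀ + U)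
    {k : ℕ} (hk : k = K) {Fhat : Matrix (Fin n) (Fin k) ℝ} (hF : IsPCAFactor X Fhat)
    (hn : 2 ≤ n) {δ θ η c τ : ℝ} (hθ0 : 0 < θ) (hθ1 : θ ≤ 1) (hθδ : 6 * θ ≤ δ) (hη : 0 ≤ η)
    (hc : 0 < c) (hp : 0 < p) (hτ : c ^ 2 * p ≤ τ)
    (hηδ : (1 + θ⁻¹) * (32 * K * η ^ 2) < δ / 2 * c ^ 2)
    (hdiag : ∀ i, U i ⬝ᵥ U i ≤ η * n * Real.sqrt p)
    (hoff : ∑ i, ∑ j, ((offGram U * offGram U) i j) ^ 2 ≤ (η * n * Real.sqrt p) ^ 4)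
    (hconc : |∑ i, ∑ j, offGram U i j ^ 2 - n * (n - 1) * τ| ≤ θ * (n * (n - 1) * τ)) :
    |traceSqEstimator (pcaResiduals X Fhat) / τ - 1| < δ := by
  have hn' : (2 : ℝ) ≤ n := by exact_mod_cast hn
  have hp' : (0 : ℝ) < p := by exact_mod_cast hp
  have hτ0 : 0 < τ := lt_of_lt_of_le (by positivity) hτ
  set N : ℝ := n * (n - 1) with hN
  have hN0 : 0 < N := mul_pos (by linarith) (by linarith)
  have hNn : (n : ℝ) ^ 2 ≤ 2 * N := by rw [hN]; nlinarith
  set R := pcaResiduals X Fhat with hR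
  set s := η * n * Real.sqrt p with hs
  have hs0 : 0 ≤ s := by positivity
  have hq := gram_quadraticForm_le U hs0 hdiag hoff
  have hD := sum_sq_residual_gram_sub_le hX hq (by linarith) (by omega) hk hF
  have hcmp := abs_sum_offGram_sub_le R U hθ0
  rw [← hR] at hD
  set SR := ∑ i, ∑ j, offGram R i j ^ 2
  set SU := ∑ i, ∑ j, offGram U i j ^ 2
  set D := ∑ i, ∑ j, ((R * Rᵀ - U * Uᵀ) i j) ^ 2
  have hss : (s + s) ^ 2 = 4 * η ^ 2 * n ^ 2 * p := by
    rw [hs, show (η * n * Real.sqrt p + η * n * Real.sqrt p) ^ 2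
      = 4 * η ^ 2 * n ^ 2 * Real.sqrt p ^ 2 by ring, Real.sq_sqrt hp'.le]
  -- `4 K (2 s)² = 16 K η² n² p`, and `n² ≤ 2 N` doubles the constant.
  have hD2 : D ≤ 32 * K * η ^ 2 * (N * p) := by
    refine hD.trans ?_
    rw [hss]
    push_cast
    have := mul_le_mul_of_nonneg_left hNn (show 0 ≤ 16 * K * η ^ 2 * (p : ℝ) by positivity)
    linarith
  have hD3 : (1 + θ⁻¹) * D < δ / 2 * (N * τ) := by
    calc (1 + θ⁻¹) * D ≤ (1 + θ⁻¹) * (32 * K * η ^ 2 * (N * p)) := by gcongr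
      _ = (1 + θ⁻¹) * (32 * K * η ^ 2) * (N * p) := by ring
      _ < δ / 2 * c ^ 2 * (N * p) := by gcongr
      _ = δ / 2 * (N * (c ^ 2 * p)) := by ring
      _ ≤ δ / 2 * (N * τ) := by
        have : 0 < δ := by linarith
        gcongr
  have hNτ : 0 < N * τ := by positivity
  have hfin := abs_sub_lt_of_relative_error hθ0.le hθ1 hθδ hNτ hconc hcmp hD3
  rw [traceSqEstimator_eq, ← hN]
  have : N⁻¹ * SR / τ - 1 = (SR - N * τ) / (N * τ) := by field_simp
  rw [this, abs_div, abs_of_pos hNτ, div_lt_iff₀ hNτ]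
  exact hfin

end Deterministic

/-! ### Probability of the exceptional event -/

section Exceptional

variable {p : ℕ}

/-- The event that the diagonal of the Gram matrix is large, that its off-diagonal part has a
large operator norm, or that the oracle estimator is far from its mean `τ`. -/
def exceptionalSet (n p : ℕ) (η θ τ : ℝ) : Set (Fin n → Fin p → ℝ) :=
  (⋃ i, {x | η * n * Real.sqrt p ≤ x i ⬝ᵥ x i}) ∪
    {x | (η * n * Real.sqrt p) ^ 4 ≤ ∑ i, ∑ j, ((offGram x * offGram x) i j) ^ 2} ∪
    {x | (θ * (n * (n - 1) * τ)) ^ 2 ≤ (∑ i, ∑ j, offGram x i j ^ 2 - n * (n - 1) * τ) ^ 2}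

theorem measure_ge_le_ofReal_of_integral_le {α : Type*} [MeasurableSpace α] {μ : Measure α}
    [IsFiniteMeasure μ] {f : α → ℝ} (hf0 : ∀ x, 0 ≤ f x) (hf : Integrable f μ) {a C : ℝ}
    (ha : 0 < a) (hC : ∫ x, f x ∂μ ≤ C) : μ {x | a ≤ f x} ≤ ENNReal.ofReal (C / a) := by
  have h := (mul_meas_ge_le_integral_of_nonneg (ae_of_all _ hf0) hf a).trans hC
  rw [← ENNReal.ofReal_toReal (measure_ne_top μ {x | a ≤ f x})]
  apply ENNReal.ofReal_le_ofReal
  rw [le_div_iff₀ ha, mul_comm]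
  exact h

/-- The three terms are a union bound over exponential tails, Markov for the squared Frobenius norm
of the squared off-diagonal Gram matrix, and Chebyshev for the oracle sum. -/
theorem measure_exceptionalSet_le {n : ℕ} {ν : Measure (Fin p → ℝ)} [IsProbabilityMeasure ν]
    {b c₁ c₂ η θ : ℝ} (h : SubGaussianLaw ν b) (hb : 0 < b) (hη : 0 < η) (hθ : 0 < θ)
    (hc₁ : 0 < c₁) (hn : 2 ≤ n) (hp : 0 < p)
    (hτ2 : c₁ ^ 2 * p ≤ (secondMoment ν ^ 2).trace)
    (hτ4 : 0 ≤ (secondMoment ν ^ 4).trace) (hτ4' : (secondMoment ν ^ 4).trace ≤ c₂ ^ 4 * p) :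
    (Measure.pi fun _ : Fin n => ν) (exceptionalSet n p η θ (secondMoment ν ^ 2).trace) ≤
      ENNReal.ofReal (2 * (n * Real.exp (-(η / b ^ 2 * (n / Real.sqrt p))))) +
      ENNReal.ofReal (32 * b ^ 8 / η ^ 4 * (n : ℝ)⁻¹ + c₂ ^ 4 / η ^ 4 * (p : ℝ)⁻¹) +
      ENNReal.ofReal (256 * b ^ 8 / (θ ^ 2 * c₁ ^ 4) * (n : ℝ)⁻¹) := by
  have hn' : (2 : ℝ) ≤ n := by exact_mod_cast hn
  have hn0 : (0 : ℝ) < n := by linarith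
  have hp' : (0 : ℝ) < p := by exact_mod_cast hp
  set τ := (secondMoment ν ^ 2).trace
  have hτ0 : 0 < τ := lt_of_lt_of_le (by positivity) hτ2
  have hsq : Real.sqrt p ^ 2 = p := Real.sq_sqrt hp'.le
  have hsq0 : 0 < Real.sqrt p := Real.sqrt_pos.2 hp'
  refine (measure_union_le _ _).trans (add_le_add ((measure_union_le _ _).trans
    (add_le_add ?_ ?_)) ?_)
  · have hi : ∀ i : Fin n, (Measure.pi fun _ : Fin n => ν)
        {x | η * n * Real.sqrt p ≤ x i ⬝ᵥ x i} ≤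
        ENNReal.ofReal (2 * Real.exp (-(η / b ^ 2 * (n / Real.sqrt p)))) := by
      intro i
      have hm := (measurePreserving_eval (fun _ : Fin n => ν) i)
      -- The tail parameter is chosen so that `p b² t = η n √p`.
      have h1 := h.measure_normSq_ge_le hb hp (η / b ^ 2 * (n / Real.sqrt p))
      have h2 : (p : ℝ) * b ^ 2 * (η / b ^ 2 * (n / Real.sqrt p)) = η * n * Real.sqrt p := by
        field_simp
        rw [hsq]
      rw [h2] at h1
      have hms : MeasurableSet {y : Fin p → ℝ | η * n * Real.sqrt p ≤ y ⬝ᵥ y} := by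
        apply measurableSet_le measurable_const
        unfold dotProduct; fun_prop
      exact (hm.measure_preimage hms.nullMeasurableSet).trans_le h1
    refine (measure_iUnion_le _).trans ?_
    rw [tsum_fintype]
    refine (Finset.sum_le_sum fun i _ => hi i).trans_eq ?_
    rw [Finset.sum_const, Finset.card_univ, Fintype.card_fin, nsmul_eq_mul,
      ← ENNReal.ofReal_natCast, ← ENNReal.ofReal_mul hn0.le]
    congr 1; ring
  · obtain ⟨hI, hle⟩ := h.integral_sum_offGram_sq_le (n := n) hb hτ4
    refine (measure_ge_le_ofReal_of_integral_le (fun x => by positivity) hI (by positivity)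
      hle).trans (ENNReal.ofReal_le_ofReal ?_)
    have e : (η * n * Real.sqrt p) ^ 4 = η ^ 4 * n ^ 4 * p ^ 2 := by
      rw [show (p : ℝ) ^ 2 = (Real.sqrt p ^ 2) ^ 2 by rw [hsq]]; ring
    rw [e, div_le_iff₀ (by positivity)]
    calc _ ≤ 2 * (n : ℝ) ^ 3 * (16 * b ^ 8 * p ^ 2) + n ^ 4 * (c₂ ^ 4 * p) := by gcongr
      _ = _ := by field_simp; ring
  · obtain ⟨hI, hle⟩ := h.integral_sum_offGram_sub_sq_le (n := n) hb
    have hN0 : (0 : ℝ) < n * (n - 1) := mul_pos hn0 (by linarith)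
    have hNn : (n : ℝ) ^ 2 / 2 ≤ n * (n - 1) := by nlinarith
    refine (measure_ge_le_ofReal_of_integral_le (fun x => by positivity) hI (by positivity)
      hle).trans (ENNReal.ofReal_le_ofReal ?_)
    calc _ ≤ 4 * (n : ℝ) ^ 3 * (16 * b ^ 8 * p ^ 2) /
          (θ * ((n : ℝ) ^ 2 / 2 * (c₁ ^ 2 * p))) ^ 2 := by gcongr
      _ = _ := by field_simp; ring

/-- Since `√(q n) ≤ √C n ^ (a / 2)`, the exponent is at least a multiple of `n ^ (1 - a / 2)`, a
positive power, which beats the prefactor `n`. -/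
theorem tendsto_mul_exp_neg_div_sqrt {q : ℕ → ℕ} {a : ℝ} (ha : a < 2)
    (hq : (fun n : ℕ => (q n : ℝ)) =O[atTop] fun n : ℕ => (n : ℝ) ^ a)
    (hq0 : ∀ᶠ n in atTop, 0 < q n) {κ : ℝ} (hκ : 0 < κ) :
    Tendsto (fun n : ℕ => (n : ℝ) * Real.exp (-(κ * (n / Real.sqrt (q n))))) atTop (𝓝 0) := by
  obtain ⟨C, hC0, hC⟩ := hq.exists_pos
  rw [Asymptotics.IsBigOWith] at hC
  set d : ℝ := 1 - a / 2 with hd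
  have hd0 : 0 < d := by rw [hd]; linarith
  have hlim : Tendsto (fun n : ℕ => ((n : ℝ) ^ d) ^ d⁻¹ *
      Real.exp (-(κ / Real.sqrt C) * (n : ℝ) ^ d)) atTop (𝓝 0) :=
    (tendsto_rpow_mul_exp_neg_mul_atTop_nhds_zero d⁻¹ (κ / Real.sqrt C) (by positivity)).comp
      ((tendsto_rpow_atTop hd0).comp tendsto_natCast_atTop_atTop)
  refine squeeze_zero' (Eventually.of_forall fun n => by positivity) ?_ hlim
  filter_upwards [hC, hq0, eventually_gt_atTop 0] with n hn hqn hn0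
  have hn0' : (0 : ℝ) < n := by exact_mod_cast hn0
  have hqn' : (0 : ℝ) < q n := by exact_mod_cast hqn
  rw [Real.norm_of_nonneg hqn'.le, Real.norm_of_nonneg (by positivity)] at hn
  have e1 : ((n : ℝ) ^ d) ^ d⁻¹ = n := by
    rw [← Real.rpow_mul hn0'.le, mul_inv_cancel₀ hd0.ne', Real.rpow_one]
  rw [e1]
  have e2 : Real.sqrt (q n) ≤ Real.sqrt C * (n : ℝ) ^ (a / 2) := by
    rw [Real.sqrt_le_left (by positivity), mul_pow, Real.sq_sqrt hC0.le, ← Real.rpow_natCast,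
      ← Real.rpow_mul hn0'.le]
    simpa using hn
  have e3 : (n : ℝ) ^ d * (n : ℝ) ^ (a / 2) = n := by
    rw [← Real.rpow_add hn0', hd, sub_add_cancel, Real.rpow_one]
  gcongr
  rw [neg_mul, neg_le_neg_iff, div_mul_eq_mul_div, mul_div_assoc]
  refine mul_le_mul_of_nonneg_left ?_ hκ.le
  rw [div_le_div_iff₀ (by positivity) (by positivity)]
  calc (n : ℝ) ^ d * Real.sqrt (q n) ≤ (n : ℝ) ^ d * (Real.sqrt C * (n : ℝ) ^ (a / 2)) := by gcongr
    _ = ((n : ℝ) ^ d * (n : ℝ) ^ (a / 2)) * Real.sqrt C := by ring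
    _ = n * Real.sqrt C := by rw [e3]

end Exceptional

/-! ### The factor augmented regression model -/

namespace FARM

variable {K p n : ℕ} {Ω : Type*}

theorem X_eq (M : FARM K p n Ω) (ω : Ω) :
    M.X ω = Matrix.of (fun i => M.fs i ω) * M.Bᵀ + Matrix.of fun i => M.us i ω := by
  ext i j
  simp [X, xs, Matrix.mul_apply, Matrix.mulVec, dotProduct, mul_comm]

variable [MeasurableSpace Ω] {M : FARM K p n Ω} {P : Measure Ω}

theorem IsModel.aemeasurable_us (h : M.IsModel P) (i : Fin n) : AEMeasurable (M.us i) P :=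
  (measurable_fst.comp measurable_snd).comp_aemeasurable (h.ident_sample i).aemeasurable_fst

/-- Moves every probability estimate from the abstract space to the product measure. -/
theorem IsModel.map_us_eq [IsProbabilityMeasure P] (h : M.IsModel P) :
    P.map (fun ω i => M.us i ω) = Measure.pi fun _ : Fin n => P.map M.u := by
  have hm : Measurable fun z : (Fin K → ℝ) × (Fin p → ℝ) × ℝ => z.2.1 := by fun_prop
  have hind : iIndepFun (fun i ω => M.us i ω) P := h.indep_sample.comp (fun _ z => z.2.1) fun _ => hm
  rw [hind.map_fun_eq_pi_map h.aemeasurable_us]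
  congr 1
  ext1 i
  exact ((h.ident_sample i).comp hm).map_eq

theorem IsModel.sigmaU_eq (h : M.IsModel P) : M.SigmaU P = secondMoment (P.map M.u) := by
  ext j k
  have hf : Measurable fun y : Fin p → ℝ => y j * y k := by fun_prop
  simp only [SigmaU, secondMoment, Matrix.of_apply]
  rw [integral_map h.aemeasurable_u hf.aestronglyMeasurable]

theorem IsModel.subGaussianLaw (h : M.IsModel P) {c₀ b : ℝ} (hc : c₀ < b) (hb : 0 < b)
    (hu : vecSubGaussianNorm P M.u ≤ ENNReal.ofReal c₀) : SubGaussianLaw (P.map M.u) b := by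
  intro w hw
  have h1 : subGaussianNorm P (fun ω => w ⬝ᵥ M.u ω) ≤ ENNReal.ofReal c₀ :=
    (le_iSup₂ (f := fun (c : Fin p → ℝ) (_ : ∑ j, c j ^ 2 = 1) =>
      subGaussianNorm P fun ω => c ⬝ᵥ M.u ω) w hw).trans hu
  have h2 := lintegral_exp_le_two_of_subGaussianNorm_lt
    (h1.trans_lt ((ENNReal.ofReal_lt_ofReal_iff hb).2 hc))
  rw [lintegral_map' (Measurable.aemeasurable (by unfold dotProduct; fun_prop)) h.aemeasurable_u]
  exact h2

theorem sigmaU_isHermitian (M : FARM K p n Ω) (P : Measure Ω) : (M.SigmaU P).IsHermitian := by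
  ext j k
  simp [SigmaU, mul_comm]

theorem le_trace_sigmaU_sq {c₁ c₂ : ℝ} (hc : 0 < c₁)
    (h : ∀ t ∈ spectrum ℝ (M.SigmaU P), c₁ < t ∧ t ≤ c₂) :
    c₁ ^ 2 * p ≤ (M.SigmaU P ^ 2).trace := by
  have hS := M.sigmaU_isHermitian P
  rw [hS.trace_sq]
  calc c₁ ^ 2 * p = ∑ _i : Fin p, c₁ ^ 2 := by simp [mul_comm]
    _ ≤ _ := Finset.sum_le_sum fun i _ => by
      have := (h _ (hS.eigenvalues_mem_spectrum_real i)).1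
      gcongr

theorem trace_sigmaU_pow_four_nonneg : 0 ≤ (M.SigmaU P ^ 4).trace := by
  rw [(M.sigmaU_isHermitian P).trace_pow_four]
  positivity

theorem trace_sigmaU_pow_four_le {c₁ c₂ : ℝ} (hc : 0 < c₁)
    (h : ∀ t ∈ spectrum ℝ (M.SigmaU P), c₁ < t ∧ t ≤ c₂) :
    (M.SigmaU P ^ 4).trace ≤ c₂ ^ 4 * p := by
  have hS := M.sigmaU_isHermitian P
  rw [hS.trace_pow_four]
  calc _ ≤ ∑ _i : Fin p, c₂ ^ 4 := Finset.sum_le_sum fun i _ => by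
        have := h _ (hS.eigenvalues_mem_spectrum_real i)
        have h0 := hc.trans this.1
        gcongr
        exact this.2
    _ = c₂ ^ 4 * p := by simp [mul_comm]

end FARM

/-- Ratio consistency of the trace estimator. By the interlacing bound in
`sum_sq_residual_gram_sub_le`, only the behaviour of the idiosyncratic sample enters: no rate for
the estimated factors or for the pilot estimators is needed. -/
theorem mainTheorem8
    {Ω : ℕ → Type*} [∀ n, MeasurableSpace (Ω n)]
    (P : ∀ n, Measure (Ω n)) [∀ n, IsProbabilityMeasure (P n)]
    -- fixed number `K` of factors; dimension `p = p_n`, with `p ≍ n ^ a`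
    (K : ℕ) (p : ℕ → ℕ) (a : ℝ) (ha₁ : 2 / 3 < a) (ha₂ : a < 2)
    (hp : (fun n : ℕ => (p n : ℝ)) =Θ[atTop] (fun n : ℕ => (n : ℝ) ^ a))
    -- the model
    (M : ∀ n, FARM K (p n) n (Ω n))
    (hmodel : ∀ n, (M n).IsModel (P n))
    (hident : ∀ n, (M n).IsIdentified (P n))
    -- regularity, with constants that do not depend on `n`
    (c₀ b₁ b₂ C₁ C₂ c₁ c₂ c₃ c : ℝ)
    (hc₀ : 0 < c₀) (hb₁ : 0 < b₁) (hc₁ : 0 < c₁) (hc₁₂ : c₁ < c₂) (hc₃ : 0 < c₃) (hc : 0 < c)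
    (hreg : ∀ᶠ n in atTop, (M n).IsRegular (P n) c₀ b₁ b₂ C₁ C₂ c₁ c₂)
    -- pilot estimators of the covariance matrix of `x` and of its leading eigensystem
    (lam : ∀ _ : ℕ, Fin K → ℝ) (Gam : ∀ n, Matrix (Fin (p n)) (Fin K) ℝ)
    (hlamGam : ∀ᶠ n in atTop, IsLeadingEigensystem ((M n).SigmaX (P n)) (lam n) (Gam n))
    (Sighat : ∀ n, Ω n → Matrix (Fin (p n)) (Fin (p n)) ℝ)
    (lamhat : ∀ n, Ω n → Fin K → ℝ)
    (Gamhat : ∀ n, Ω n → Matrix (Fin (p n)) (Fin K) ℝ)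
    (hSighat : IsBigOInProb P
      (fun n ω => matMaxNorm (Sighat n ω - (M n).SigmaX (P n)))
      (fun n => Real.sqrt (Real.log (p n) / n)))
    (hlamhat : IsBigOInProb P
      (fun n ω => matMaxNorm
        ((Matrix.diagonal (lamhat n ω) - Matrix.diagonal (lam n)) *
          (Matrix.diagonal (lamhat n ω))⁻¹))
      (fun n => Real.sqrt (Real.log (p n) / n)))
    (hGamhat : IsBigOInProb P
      (fun n ω => matMaxNorm (Gamhat n ω - Gam n))
      (fun n => Real.sqrt (Real.log (p n) / (n * p n))))
    -- sub-Gaussian noise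
    (hε : ∀ᶠ n in atTop, subGaussianNorm (P n) (M n).ε ≤ ENNReal.ofReal c₃)
    -- the normalized projections `p⁻¹ B_kᵀ x` are sub-Gaussian
    (hBx : ∀ᶠ n in atTop, ∀ k : Fin K,
      subGaussianNorm (P n)
        (fun ω => (p n : ℝ)⁻¹ * ((fun j => (M n).B j k) ⬝ᵥ (M n).x ω)) ≤ ENNReal.ofReal c)
    -- a consistent estimator of the number of factors, and the PCA factor estimates
    (Khat : ∀ n, Ω n → ℕ)
    (hKhat : Tendsto (fun n => P n {ω | Khat n ω ≠ K}) atTop (𝓝 0))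
    (Fhat : ∀ (n : ℕ) (ω : Ω n), Matrix (Fin n) (Fin (Khat n ω)) ℝ)
    (hFhat : ∀ n, ∀ᵐ ω ∂(P n), Khat n ω ≤ n → IsPCAFactor ((M n).X ω) (Fhat n ω)) :
    -- ratio consistency
    ∀ δ : ℝ, 0 < δ →
      Tendsto
        (fun n => P n {ω |
          δ ≤ |traceSqEstimator (pcaResiduals ((M n).X ω) (Fhat n ω)) /
                Matrix.trace ((M n).SigmaU (P n) ^ 2) - 1|})
        atTop (𝓝 0) := by
  intro δ hδ
  set θ : ℝ := min 1 (δ / 6) with hθdef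
  have hθ0 : 0 < θ := by positivity
  have hθ1 : θ ≤ 1 := min_le_left _ _
  have hθδ : 6 * θ ≤ δ := by linarith [min_le_right 1 (δ / 6)]
  -- `η` is the tolerated size of `s / (n √p)`; the left side vanishes as `η` tends to zero with `θ`
  -- fixed.
  obtain ⟨η, hη0, hη⟩ : ∃ η : ℝ, 0 < η ∧ (1 + θ⁻¹) * (32 * K * η ^ 2) < δ / 2 * c₁ ^ 2 := by
    have hcont : Tendsto (fun η : ℝ => (1 + θ⁻¹) * (32 * K * η ^ 2)) (𝓝[>] 0)
        (𝓝 ((1 + θ⁻¹) * (32 * K * 0 ^ 2))) :=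
      ((by fun_prop : Continuous fun η : ℝ => (1 + θ⁻¹) * (32 * K * η ^ 2)).tendsto 0).mono_left
        nhdsWithin_le_nhds
    have hpos : (1 + θ⁻¹) * (32 * K * 0 ^ 2) < δ / 2 * c₁ ^ 2 := by
      rw [show (1 + θ⁻¹) * (32 * K * 0 ^ 2) = (0 : ℝ) by ring]; positivity
    obtain ⟨η, h1, h2⟩ := ((hcont.eventually_lt_const hpos).and self_mem_nhdsWithin).exists
    exact ⟨η, h2, h1⟩
  -- Any scale strictly above `c₀` serves; strictness avoids attainment of the infimum in the norm.
  set b : ℝ := 2 * c₀ with hb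
  have hb0 : 0 < b := by positivity
  have hptop : Tendsto (fun n => (p n : ℝ)) atTop atTop := by
    have hn : Tendsto (fun n : ℕ => ‖(n : ℝ) ^ a‖) atTop atTop :=
      tendsto_norm_atTop_atTop.comp
        ((tendsto_rpow_atTop (by linarith)).comp tendsto_natCast_atTop_atTop)
    have := hp.tendsto_norm_atTop_iff.2 hn
    simpa [Function.comp_def] using this
  have hp0 : ∀ᶠ n in atTop, 0 < p n := by
    filter_upwards [hptop.eventually_gt_atTop 0] with n hn
    exact_mod_cast hn
  let bound : ℕ → ℝ≥0∞ := fun n =>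
    ENNReal.ofReal (2 * (n * Real.exp (-(η / b ^ 2 * (n / Real.sqrt (p n)))))) +
      ENNReal.ofReal (32 * b ^ 8 / η ^ 4 * (n : ℝ)⁻¹ + c₂ ^ 4 / η ^ 4 * (p n : ℝ)⁻¹) +
      ENNReal.ofReal (256 * b ^ 8 / (θ ^ 2 * c₁ ^ 4) * (n : ℝ)⁻¹)
  have hninv : Tendsto (fun n : ℕ => (n : ℝ)⁻¹) atTop (𝓝 0) := tendsto_inv_atTop_nhds_zero_nat
  have hbound : Tendsto bound atTop (𝓝 0) := by
    have h1 := ENNReal.tendsto_ofReal ((tendsto_mul_exp_neg_div_sqrt ha₂ hp.1 hp0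
      (show 0 < η / b ^ 2 by positivity)).const_mul 2)
    have h2 := ENNReal.tendsto_ofReal ((hninv.const_mul (32 * b ^ 8 / η ^ 4)).add
      (hptop.inv_tendsto_atTop.const_mul (c₂ ^ 4 / η ^ 4)))
    have h3 := ENNReal.tendsto_ofReal (hninv.const_mul (256 * b ^ 8 / (θ ^ 2 * c₁ ^ 4)))
    have h := (h1.add h2).add h3
    simp only [mul_zero, add_zero, ENNReal.ofReal_zero] at h
    exact h
  have hlim : Tendsto (fun n => P n {ω | Khat n ω ≠ K} + bound n) atTop (𝓝 0) := by
    simpa using hKhat.add hbound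
  refine tendsto_of_tendsto_of_tendsto_of_le_of_le' tendsto_const_nhds hlim
    (Eventually.of_forall fun n => zero_le) ?_
  -- `K ≤ n` ensures that `Khat n ω = K` implies the premise `Khat n ω ≤ n` of `hFhat`.
  filter_upwards [hreg, hp0, eventually_ge_atTop 2, eventually_ge_atTop K] with n hr hpn hn2 hnK
  have hS := (hmodel n).sigmaU_eq
  have hτ2 := FARM.le_trace_sigmaU_sq hc₁ hr.eigen_SigmaU
  have hτ4 := FARM.trace_sigmaU_pow_four_nonneg (M := M n) (P := P n)
  have hτ4' := FARM.trace_sigmaU_pow_four_le hc₁ hr.eigen_SigmaU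
  have hlaw := (hmodel n).subGaussianLaw (show c₀ < b by linarith) hb0 hr.subGaussian_u
  have hν : IsProbabilityMeasure ((P n).map (M n).u) :=
    Measure.isProbabilityMeasure_map (hmodel n).aemeasurable_u
  have hexc : (P n) {ω | (fun i => (M n).us i ω) ∈
      exceptionalSet n (p n) η θ ((M n).SigmaU (P n) ^ 2).trace} ≤ bound n := by
    -- This inequality holds for outer measure, so the exceptional set need not be shown measurable.
    refine (Measure.le_map_apply (f := fun ω i => (M n).us i ω)
      (aemeasurable_pi_lambda _ (hmodel n).aemeasurable_us) _).trans ?_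
    rw [(hmodel n).map_us_eq, hS]
    rw [hS] at hτ2 hτ4 hτ4'
    exact measure_exceptionalSet_le hlaw hb0 hη0 hθ0 hc₁ hn2 hpn hτ2 hτ4 hτ4'
  have hnull : (P n) {ω | ¬ (Khat n ω ≤ n → IsPCAFactor ((M n).X ω) (Fhat n ω))} = 0 :=
    ae_iff.1 (hFhat n)
  refine (measure_mono (t := ({ω | Khat n ω ≠ K} ∪
    {ω | ¬ (Khat n ω ≤ n → IsPCAFactor ((M n).X ω) (Fhat n ω))}) ∪
    {ω | (fun i => (M n).us i ω) ∈
      exceptionalSet n (p n) η θ ((M n).SigmaU (P n) ^ 2).trace}) ?_).trans ?_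
  · intro ω hω
    by_contra hcon
    simp only [Set.mem_union, not_or] at hcon
    obtain ⟨⟨hK, hF⟩, hE⟩ := hcon
    have hK' : Khat n ω = K := not_not.1 hK
    have hF' := not_not.1 hF (hK'.trans_le hnK)
    have hE' : (fun i => (M n).us i ω) ∉
      exceptionalSet n (p n) η θ ((M n).SigmaU (P n) ^ 2).trace := hE
    simp only [exceptionalSet, Set.mem_union, Set.mem_iUnion, Set.mem_ofPred_eq, not_or,
      not_exists, not_le] at hE'
    obtain ⟨⟨h1, h2⟩, h3⟩ := hE'
    have hn' : (2 : ℝ) ≤ n := by exact_mod_cast hn2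
    have hτ0 : 0 ≤ ((M n).SigmaU (P n) ^ 2).trace := le_trans (by positivity) hτ2
    have hN0 : 0 ≤ (n : ℝ) * (n - 1) * ((M n).SigmaU (P n) ^ 2).trace :=
      mul_nonneg (mul_nonneg (by linarith) (by linarith)) hτ0
    refine absurd (abs_ratio_sub_one_lt ((M n).X_eq ω) hK' hF' hn2 hθ0 hθ1 hθδ hη0.le hc₁ hpn hτ2 hη
      (fun i => (h1 i).le) h2.le ?_) (not_lt.2 hω)
    exact abs_le_of_sq_le_sq h3.le (mul_nonneg hθ0.le hN0)
  · refine (measure_union_le _ _).trans (add_le_add ((measure_union_le _ _).trans ?_) hexc)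
    rw [hnull, add_zero]
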